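/- Let $X$ be a real or complex Banach space with dual $X^*$, and let $\tau=\tau(X^*,X)$ be the Mackey topology on $X^*$, that is, the topology of uniform convergence on the weakly compact absolutely convex subsets of $X$. Let $\tau^+$ be the finest locally convex topology on $X^*$ with the same convergent sequences as $\tau$, and let $\tau^p$ be the finest locally convex topology on $X^*$ with the same precompact sets as $\tau$. Say that $X$ has the reciprocal Dunford–Pettis property (RDP) if, for every Banach space $Y$, every bounded linear operator $T:X\to Y$ that maps weakly compact sets to norm compact sets is weakly compact, that is, maps the closed unit ball of $X$ to a relatively weakly compact subset of $Y$. Then $\tau^+=\tau^p$ if and only if $X$ has the RDP. -/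

import Mathlib

open Filter Topology Set
open scoped Pointwise

universe u v

section Definitions

open scoped ComplexOrder

/-- `t` is a locally convex vector space topology on the `𝕜`-vector space `E`. -/
structure IsLocallyConvexTopology (𝕜 : Type*) [RCLike 𝕜] {E : Type*} [AddCommGroup E] [Module 𝕜 E]
    (t : TopologicalSpace E) : Prop where
  isTopologicalAddGroup : @IsTopologicalAddGroup E t _
  continuousSMul : @ContinuousSMul 𝕜 E _ _ t
  locallyConvexSpace : @LocallyConvexSpace 𝕜 E _ _ _ _ t

/-- `s` and `t` have the same convergent sequences (with the same limits). -/
def SameConvergentSequences {E : Type*} (s t : TopologicalSpace E) : Prop :=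
  ∀ (x : ℕ → E) (a : E), Tendsto x atTop (@nhds E s a) ↔ Tendsto x atTop (@nhds E t a)

/-- `A` is precompact (totally bounded) for the group topology `t` on `E`: it is covered by
finitely many translates of each neighbourhood of `0`. -/
def IsPrecompactFor {E : Type*} [AddCommGroup E] (t : TopologicalSpace E) (A : Set E) : Prop :=
  ∀ U ∈ @nhds E t 0, ∃ F : Set E, F.Finite ∧ A ⊆ F + U

/-- `s` and `t` have the same precompact sets. -/
def SamePrecompactSets {E : Type*} [AddCommGroup E] (s t : TopologicalSpace E) : Prop :=
  ∀ A : Set E, IsPrecompactFor s A ↔ IsPrecompactFor t A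

/-- `t⁺`: the finest locally convex topology with the same convergent sequences as `t`.
In Mathlib's order on topologies `s ≤ t` means that `s` is finer than `t`, so the least upper bound
of a family in the usual order "coarser than" is its `sInf`. That it is again a member of
the family is proved in `isLeast_plusTopology`. -/
@[reducible] def plusTopology (𝕜 : Type*) [RCLike 𝕜] {E : Type*} [AddCommGroup E] [Module 𝕜 E]
    (t : TopologicalSpace E) : TopologicalSpace E :=
  sInf {s | IsLocallyConvexTopology 𝕜 s ∧ SameConvergentSequences s t}

/-- `tᵖ`: the finest locally convex topology with the same precompact sets as `t`
(see `isLeast_precompactTopology`). -/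
@[reducible] def precompactTopology (𝕜 : Type*) [RCLike 𝕜] {E : Type*} [AddCommGroup E] [Module 𝕜 E]
    (t : TopologicalSpace E) : TopologicalSpace E :=
  sInf {s | IsLocallyConvexTopology 𝕜 s ∧ SamePrecompactSets s t}

/-- `K` is compact for the weak topology `σ(X, X*)`. -/
def IsWeaklyCompact (𝕜 : Type*) [RCLike 𝕜] {X : Type*} [NormedAddCommGroup X] [NormedSpace 𝕜 X]
    (K : Set X) : Prop :=
  IsCompact (toWeakSpace 𝕜 X '' K)

/-- The family of weakly compact absolutely convex subsets of `X`. -/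
def weaklyCompactDiscs (𝕜 : Type*) [RCLike 𝕜] (X : Type*) [NormedAddCommGroup X]
    [NormedSpace 𝕜 X] : Set (Set X) :=
  {K | IsWeaklyCompact 𝕜 K ∧ AbsConvex 𝕜 K}

/-- The Mackey topology `τ(X*, X)` on `X*`: uniform convergence on the weakly compact absolutely
convex subsets of `X`. -/
@[reducible] def mackeyTopology (𝕜 : Type*) [RCLike 𝕜] (X : Type*) [NormedAddCommGroup X]
    [NormedSpace 𝕜 X] : TopologicalSpace (StrongDual 𝕜 X) :=
  UniformConvergenceCLM.instTopologicalSpace (RingHom.id 𝕜) 𝕜 (weaklyCompactDiscs 𝕜 X)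

/-- A Dunford-Pettis operator: it maps weakly compact sets to norm compact sets. -/
def IsDunfordPettisOperator {𝕜 : Type*} [RCLike 𝕜] {X Y : Type*} [NormedAddCommGroup X]
    [NormedSpace 𝕜 X] [NormedAddCommGroup Y] [NormedSpace 𝕜 Y] (T : X →L[𝕜] Y) : Prop :=
  ∀ K : Set X, IsWeaklyCompact 𝕜 K → IsCompact (T '' K)

/-- A weakly compact operator: the image of the closed unit ball is relatively weakly compact. -/
def IsWeaklyCompactOperator {𝕜 : Type*} [RCLike 𝕜] {X Y : Type*} [NormedAddCommGroup X]
    [NormedSpace 𝕜 X] [NormedAddCommGroup Y] [NormedSpace 𝕜 Y] (T : X →L[𝕜] Y) : Prop :=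
  IsCompact (closure (toWeakSpace 𝕜 Y '' (T '' Metric.closedBall (0 : X) 1)))

/-- The reciprocal Dunford-Pettis property: every Dunford-Pettis operator from `X` to a Banach
space is weakly compact. (The universe of `Y` is no restriction: one may replace `Y` by the closure
of the range of `T`, whose cardinality is at most that of the set of sequences in `X`.) -/
def HasReciprocalDunfordPettisProperty (𝕜 : Type v) [RCLike 𝕜] (X : Type u)
    [NormedAddCommGroup X] [NormedSpace 𝕜 X] : Prop :=
  ∀ (Y : Type (max u v)) [NormedAddCommGroup Y] [NormedSpace 𝕜 Y] [CompleteSpace Y]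
    (T : X →L[𝕜] Y), IsDunfordPettisOperator T → IsWeaklyCompactOperator T

end Definitions

section BasicFacts

open scoped ComplexOrder

theorem isPrecompactFor_iff_totallyBounded {E : Type*} [AddCommGroup E] [UniformSpace E]
    [IsUniformAddGroup E] (A : Set E) :
    IsPrecompactFor (inferInstance : TopologicalSpace E) A ↔ TotallyBounded A := by
  rw [totallyBounded_iff_subset_finite_iUnion_nhds_zero]
  unfold IsPrecompactFor
  simp only [← Set.iUnion_add_left_image, Set.image_add_left, ← Set.image_vadd, vadd_eq_add]

theorem isPrecompactFor_iff_ultrafilter {E : Type*} [AddCommGroup E] (t : TopologicalSpace E)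
    (ht : @IsTopologicalAddGroup E t _) (A : Set E) :
    IsPrecompactFor t A ↔ ∀ f : Ultrafilter E, A ∈ f →
      Tendsto (fun p : E × E => p.2 - p.1) ((f : Filter E) ×ˢ (f : Filter E)) (@nhds E t 0) := by
  let : UniformSpace E := IsTopologicalAddGroup.rightUniformSpace E
  have : IsUniformAddGroup E := isUniformAddGroup_of_addCommGroup
  refine (isPrecompactFor_iff_totallyBounded A).trans ?_
  rw [totallyBounded_iff_ultrafilter]
  refine forall_congr' fun f => ?_
  rw [le_principal_iff]
  refine imp_congr Iff.rfl ?_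
  rw [cauchy_iff_le, uniformity_eq_comap_nhds_zero, ← tendsto_iff_comap]

theorem isLocallyConvexTopology_sInf {𝕜 : Type*} [RCLike 𝕜] {E : Type*} [AddCommGroup E]
    [Module 𝕜 E] {ts : Set (TopologicalSpace E)}
    (h : ∀ t ∈ ts, IsLocallyConvexTopology 𝕜 t) : IsLocallyConvexTopology 𝕜 (sInf ts) where
  isTopologicalAddGroup := topologicalAddGroup_sInf fun t ht => (h t ht).1
  continuousSMul := continuousSMul_sInf fun t ht => (h t ht).2
  locallyConvexSpace := LocallyConvexSpace.sInf fun t ht => (h t ht).3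

theorem isLeast_plusTopology {𝕜 : Type*} [RCLike 𝕜] {E : Type*} [AddCommGroup E] [Module 𝕜 E]
    {t : TopologicalSpace E} (ht : IsLocallyConvexTopology 𝕜 t) :
    IsLeast {s | IsLocallyConvexTopology 𝕜 s ∧ SameConvergentSequences s t}
      (plusTopology 𝕜 t) := by
  refine ⟨⟨isLocallyConvexTopology_sInf fun s hs => hs.1, fun x a => ?_⟩,
    fun s hs => sInf_le hs⟩
  rw [plusTopology, nhds_sInf]
  simp only [tendsto_iInf]
  exact ⟨fun h => h t ⟨ht, fun _ _ => Iff.rfl⟩, fun h s hs => (hs.2 x a).2 h⟩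

theorem isLeast_precompactTopology {𝕜 : Type*} [RCLike 𝕜] {E : Type*} [AddCommGroup E]
    [Module 𝕜 E] {t : TopologicalSpace E} (ht : IsLocallyConvexTopology 𝕜 t) :
    IsLeast {s | IsLocallyConvexTopology 𝕜 s ∧ SamePrecompactSets s t}
      (precompactTopology 𝕜 t) := by
  have hlc : IsLocallyConvexTopology 𝕜 (precompactTopology 𝕜 t) :=
    isLocallyConvexTopology_sInf fun s hs => hs.1
  refine ⟨⟨hlc, fun A => ?_⟩, fun s hs => sInf_le hs⟩
  have hle : precompactTopology 𝕜 t ≤ t := sInf_le ⟨ht, fun _ => Iff.rfl⟩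
  refine ⟨fun h U hU => h U (_root_.nhds_mono hle hU), fun h => ?_⟩
  rw [isPrecompactFor_iff_ultrafilter _ hlc.1]
  intro f hf
  rw [precompactTopology, nhds_sInf]
  simp only [tendsto_iInf]
  exact fun s hs => (isPrecompactFor_iff_ultrafilter s hs.1.1 A).1 ((hs.2 A).2 h) f hf

theorem isLocallyConvexTopology_mackeyTopology (𝕜 : Type*) [RCLike 𝕜] (X : Type*)
    [NormedAddCommGroup X] [NormedSpace 𝕜 X] :
    IsLocallyConvexTopology 𝕜 (mackeyTopology 𝕜 X) where
  isTopologicalAddGroup :=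
    UniformConvergenceCLM.instIsTopologicalAddGroup (RingHom.id 𝕜) 𝕜 (weaklyCompactDiscs 𝕜 X)
  continuousSMul := by
    refine UniformConvergenceCLM.continuousSMul (RingHom.id 𝕜) 𝕜 (weaklyCompactDiscs 𝕜 X) ?_
    intro K hK
    rw [NormedSpace.isVonNBounded_iff, isBounded_iff_forall_norm_le]
    have hb : ∀ φ : StrongDual 𝕜 X, ∃ C, ∀ x : K,
        ‖NormedSpace.inclusionInDoubleDual 𝕜 X x φ‖ ≤ C := by
      intro φ
      have hc : Continuous fun x : WeakSpace 𝕜 X => φ ((toWeakSpace 𝕜 X).symm x) :=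
        WeakBilin.eval_continuous (topDualPairing 𝕜 X).flip φ
      obtain ⟨C, hC⟩ := (hK.1.image hc).isBounded.exists_norm_le
      exact ⟨C, fun x => hC _ ⟨_, ⟨x, x.2, rfl⟩, by simp⟩⟩
    obtain ⟨C, hC⟩ := banach_steinhaus hb
    refine ⟨C, fun x hx => ?_⟩
    have := hC ⟨x, hx⟩
    rwa [← (NormedSpace.inclusionInDoubleDualLi 𝕜 (E := X)).norm_map x]
  locallyConvexSpace := by
    have : LocallyConvexSpace 𝕜 𝕜 :=
      LocallyConvexSpace.ofBasisZero 𝕜 𝕜 _ _ Metric.nhds_basis_ball fun r _ =>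
        convex_RCLike_iff_convex_real.2 (convex_ball 0 r)
    refine UniformConvergenceCLM.locallyConvexSpace 𝕜 (weaklyCompactDiscs 𝕜 X) ⟨∅, ?_⟩ ?_
    · exact ⟨by simp [IsWeaklyCompact], AbsConvex.empty⟩
    · intro K hK L hL
      rcases K.eq_empty_or_nonempty with rfl | hK0
      · exact ⟨L, hL, empty_subset _, subset_rfl⟩
      rcases L.eq_empty_or_nonempty with rfl | hL0
      · exact ⟨K, hK, subset_rfl, empty_subset _⟩
      refine ⟨K + L, ⟨?_, hK.2.1.add hL.2.1, hK.2.2.add hL.2.2⟩,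
        subset_add_left K (hL.2.1.zero_mem hL0), subset_add_right L (hK.2.1.zero_mem hK0)⟩
      have := hK.1.add hL.1
      rwa [← Set.image_add] at this

end BasicFacts

/-!
Write `τ` for the Mackey topology on `X*`. A seminorm is `τ⁺`-continuous as soon as it tends to zero
along `τ`-null sequences, and `τᵖ`-continuous as soon as all `τ`-precompact sets are precompact for
it (`mem_nhds_plusTopology`, `mem_nhds_precompactTopology`). By the duality between precompact sets
of functionals and compact operators, the `τ`-precompact sets are governed by the Dunford–Pettis
operators: the adjoint of such an operator maps the unit ball to a `τ`-precompact set
(`IsDunfordPettisOperator.isPrecompactFor`), and evaluation on a `τ`-precompact set `A` is a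
Dunford–Pettis operator `X → C_b(A)`.

If `X` has the reciprocal Dunford–Pettis property, the evaluation operator is weakly compact, so by
Gantmacher's argument `τ`-precompact sets are relatively weakly compact. Since `τᵖ` has a base of
weakly closed neighbourhoods of zero, weak limits in a `τ`-precompact set are `τᵖ`-limits
(`HasReciprocalDunfordPettisProperty.exists_tendsto_precompactTopology`). Hence `τ`-convergent
sequences converge for `τᵖ`; and by the Eberlein–Šmulian theorem sequences in a `τ`-precompact
set have `τ⁺`-convergent subsequences, so that the set is `τ⁺`-precompact. Minimality gives both
inequalities.

Conversely let `τ⁺ = τᵖ`. Every element of `X**` is `τᵖ`-continuous, hence `τ⁺`-continuous, so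
`τ`-convergent sequences are weakly convergent (`tendstoWeakly_of_plusTopology_eq`). Let `T` be a
Dunford–Pettis operator and `(gₙ)` a sequence in the unit ball of `Y*`. Rosenthal's dichotomy
(`exists_subseq_tendsto_or_independent`), applied to the functionals `gₙ ∘ T` on the unit ball of
`X`, leaves two cases. If a subsequence converges pointwise, it converges for `τ` and hence weakly.
Otherwise some subsequence is Boolean independent, and there is a measure `μ` on the unit ball of
`X**` for whose `L¹`-seminorm the subsequence is uniformly separated
(`exists_seminorm_of_independent`). By dominated convergence this seminorm vanishes along weakly
null sequences, so it is continuous for `τ⁺ = τᵖ`, and the `τ`-precompact set of all `g ∘ T` with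
`‖g‖ ≤ 1` would be precompact for it, which is absurd. Thus all sequences `gₙ ∘ T` have weakly
convergent subsequences, and an argument of James's type shows that `T` is weakly compact
(`IsDunfordPettisOperator.isWeaklyCompactOperator`).
-/

/-! ### Weak limits and Goldstine's theorem -/

section WeakLimits

/-- `x` converges weakly to `a` along `l`, that is, for the topology `σ(E, E*)`. Stated through
functionals, so that no passage to the type synonym `WeakSpace` is needed. -/
def TendstoWeakly (𝕜 : Type*) [RCLike 𝕜] {E : Type*} [NormedAddCommGroup E] [NormedSpace 𝕜 E]
    {ι : Type*} (x : ι → E) (l : Filter ι) (a : E) : Prop :=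
  ∀ φ : StrongDual 𝕜 E, Tendsto (fun i => φ (x i)) l (𝓝 (φ a))

variable {𝕜 : Type*} [RCLike 𝕜] {E : Type*} [NormedAddCommGroup E] [NormedSpace 𝕜 E]

theorem tendsto_toWeakSpace_iff {ι : Type*} {x : ι → E} {l : Filter ι} {a : E} :
    Tendsto (fun i => toWeakSpace 𝕜 E (x i)) l (𝓝 (toWeakSpace 𝕜 E a)) ↔
      TendstoWeakly 𝕜 x l a := by
  rw [(NormedSpace.isEmbedding_inclusionInDoubleDualWeak 𝕜 E).tendsto_nhds_iff,
    tendsto_iff_forall_eval_tendsto_topDualPairing]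
  rfl

theorem TendstoWeakly.unique {ι : Type*} {x : ι → E} {l : Filter ι} [l.NeBot] {a b : E}
    (ha : TendstoWeakly 𝕜 x l a) (hb : TendstoWeakly 𝕜 x l b) : a = b := by
  by_contra hab
  obtain ⟨g, -, hg⟩ := exists_dual_vector 𝕜 (a - b) (by simpa [sub_eq_zero] using hab)
  rw [map_sub, tendsto_nhds_unique (ha g) (hb g), sub_self] at hg
  exact hab (sub_eq_zero.1 (norm_eq_zero.1 (by exact_mod_cast hg.symm)))

theorem TendstoWeakly.mono {ι : Type*} {x : ι → E} {l l' : Filter ι} {a : E}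
    (ha : TendstoWeakly 𝕜 x l a) (h : l' ≤ l) : TendstoWeakly 𝕜 x l' a :=
  fun φ => (ha φ).mono_left h

theorem TendstoWeakly.comp {ι κ : Type*} {x : ι → E} {l : Filter ι} {l' : Filter κ} {a : E}
    {θ : κ → ι} (ha : TendstoWeakly 𝕜 x l a) (h : Tendsto θ l' l) :
    TendstoWeakly 𝕜 (x ∘ θ) l' a :=
  fun φ => (ha φ).comp h

/-- Mazur: a convex norm-closed set is closed under weak limits. -/
theorem TendstoWeakly.mem_closure {ι : Type*} {x : ι → E} {l : Filter ι} [l.NeBot] {a : E}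
    (ha : TendstoWeakly 𝕜 x l a) [NormedSpace ℝ E] [IsScalarTower ℝ 𝕜 E] {s : Set E}
    (hs : Convex ℝ s) (hx : ∀ᶠ i in l, x i ∈ s) : a ∈ closure s := by
  have h : toWeakSpace 𝕜 E a ∈ closure (toWeakSpace 𝕜 E '' s) :=
    mem_closure_of_tendsto (tendsto_toWeakSpace_iff.2 ha)
      (hx.mono fun i hi => mem_image_of_mem _ hi)
  rw [← hs.toWeakSpace_closure 𝕜] at h
  obtain ⟨b, hb, hab⟩ := h
  rwa [← (toWeakSpace 𝕜 E).injective hab]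

/-- A pointwise bounded family is bounded (the uniform boundedness principle, applied in the
double dual, where completeness of `E` is not needed). -/
theorem exists_norm_le_of_forall_dual {ι : Type*} (x : ι → E)
    (h : ∀ φ : StrongDual 𝕜 E, ∃ C, ∀ i, ‖φ (x i)‖ ≤ C) : ∃ C, ∀ i, ‖x i‖ ≤ C := by
  obtain ⟨C, hC⟩ := banach_steinhaus (g := fun i => NormedSpace.inclusionInDoubleDual 𝕜 E (x i)) h
  refine ⟨C, fun i => ?_⟩
  have := hC i
  rwa [← (NormedSpace.inclusionInDoubleDualLi 𝕜 (E := E)).norm_map (x i)]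

theorem TendstoWeakly.exists_norm_le {x : ℕ → E} {a : E} (ha : TendstoWeakly 𝕜 x atTop a) :
    ∃ C, ∀ n, ‖x n‖ ≤ C := by
  refine exists_norm_le_of_forall_dual (𝕜 := 𝕜) x fun φ => ?_
  obtain ⟨C, hC⟩ := (Metric.isBounded_range_of_tendsto _ (ha φ)).exists_norm_le
  exact ⟨C, fun n => hC _ ⟨n, rfl⟩⟩

theorem IsWeaklyCompact.exists_norm_le {K : Set E} (hK : IsWeaklyCompact 𝕜 K) :
    ∃ C, ∀ x ∈ K, ‖x‖ ≤ C := by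
  obtain ⟨C, hC⟩ := exists_norm_le_of_forall_dual (𝕜 := 𝕜) (fun x : K => (x : E)) fun φ => by
    have hc : Continuous fun x : WeakSpace 𝕜 E => φ ((toWeakSpace 𝕜 E).symm x) :=
      WeakBilin.eval_continuous (topDualPairing 𝕜 E).flip φ
    obtain ⟨C, hC⟩ := (hK.image hc).isBounded.exists_norm_le
    exact ⟨C, fun x => hC _ ⟨_, ⟨x, x.2, rfl⟩, by simp⟩⟩
  exact ⟨C, fun x hx => hC ⟨x, hx⟩⟩

theorem IsWeaklyCompact.exists_tendstoWeakly {K : Set E} (hK : IsWeaklyCompact 𝕜 K) {ι : Type*}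
    (U : Ultrafilter ι) {x : ι → E} (hx : ∀ᶠ i in U, x i ∈ K) :
    ∃ a ∈ K, TendstoWeakly 𝕜 x U a := by
  obtain ⟨_, ⟨a, ha, rfl⟩, h⟩ := hK.ultrafilter_le_nhds (U.map fun i => toWeakSpace 𝕜 E (x i))
    (le_principal_iff.2 (hx.mono fun i hi => mem_image_of_mem _ hi))
  exact ⟨a, ha, tendsto_toWeakSpace_iff.1 h⟩

/-- Banach–Alaoglu, for ultrafilters. -/
theorem exists_weakStar_limit {ι : Type*} (U : Ultrafilter ι) (g : ι → StrongDual 𝕜 E) {C : ℝ}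
    (hg : ∀ᶠ i in U, ‖g i‖ ≤ C) :
    ∃ g₀ : StrongDual 𝕜 E, ‖g₀‖ ≤ C ∧ ∀ x, Tendsto (fun i => g i x) U (𝓝 (g₀ x)) := by
  obtain ⟨g₀, hg₀, h⟩ := (WeakDual.isCompact_closedBall (0 : StrongDual 𝕜 E) C).ultrafilter_le_nhds
    (U.map fun i => StrongDual.toWeakDual (g i))
    (le_principal_iff.2 (hg.mono fun i hi => by simpa using hi))
  refine ⟨WeakDual.toStrongDual g₀, by simpa using hg₀, fun x => ?_⟩
  exact tendsto_iff_forall_eval_tendsto_topDualPairing.1 h x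

/-- Goldstine's theorem, finite form. -/
theorem exists_mem_ball_forall_norm_sub_lt (f : StrongDual 𝕜 (StrongDual 𝕜 E)) (hf : ‖f‖ ≤ 1)
    (s : Finset (StrongDual 𝕜 E)) {ε : ℝ} (hε : 0 < ε) :
    ∃ x : E, ‖x‖ ≤ 1 ∧ ∀ φ ∈ s, ‖φ x - f φ‖ < ε := by
  classical
  let : NormedSpace ℝ E := NormedSpace.restrictScalars ℝ 𝕜 E
  have : IsScalarTower ℝ 𝕜 E := ⟨fun r c x => by
    change (r • c) • x = (algebraMap ℝ 𝕜 r) • (c • x)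
    rw [smul_smul, Algebra.smul_def]⟩
  let L : E →L[𝕜] (s → 𝕜) := ContinuousLinearMap.pi fun φ => φ.1
  let p : s → 𝕜 := fun φ => f φ.1
  have hp : p ∈ closure (L '' Metric.closedBall 0 1) := by
    by_contra hp
    have hconv : Convex ℝ (closure (L '' Metric.closedBall 0 1)) := by
      refine Convex.closure ?_
      exact (convex_closedBall (0 : E) 1).is_linear_image (L.restrictScalars ℝ).isLinear
    obtain ⟨ℓ, c, h₁, h₂⟩ := RCLike.geometric_hahn_banach_closed_point (𝕜 := 𝕜) hconv
      isClosed_closure hp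
    let ψ : StrongDual 𝕜 E := ℓ.comp L
    have hsum : ∀ v : s → 𝕜, ℓ v = ∑ φ : s, v φ * ℓ (Pi.single φ 1) := fun v => by
      conv_lhs => rw [← Finset.univ_sum_single v, map_sum]
      refine Finset.sum_congr rfl fun φ _ => ?_
      rw [← smul_eq_mul, ← map_smul, ← Pi.single_smul, smul_eq_mul, mul_one]
    have hψ : f ψ = ℓ p := by
      have : ψ = ∑ φ : s, ℓ (Pi.single φ 1) • φ.1 := by
        ext x
        refine (hsum (L x)).trans ?_
        simp [L, mul_comm]
      rw [this, map_sum, hsum p]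
      simp [p, mul_comm]
    have hnorm : ‖ψ‖ ≤ c := by
      have hball : ∀ x : E, ‖x‖ ≤ 1 → RCLike.re (ψ x) ≤ c := fun x hx =>
        (h₁ _ (subset_closure ⟨x, by simpa using hx, rfl⟩)).le
      refine ψ.opNorm_le_of_unit_norm (by simpa using hball 0 (by simp)) fun x hx => ?_
      -- rotate `x` so that `ψ x` becomes its absolute value
      obtain ⟨z, hz, hzx⟩ := RCLike.exists_norm_eq_mul_self (ψ x)
      have := hball (z • x) (by rw [norm_smul, hz, hx, one_mul])
      rwa [map_smul, smul_eq_mul, ← hzx, RCLike.ofReal_re] at this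
    have := (RCLike.re_le_norm (f ψ)).trans ((f.le_of_opNorm_le hf ψ))
    rw [hψ] at this
    linarith
  obtain ⟨_, ⟨x, hx, rfl⟩, hd⟩ := Metric.mem_closure_iff.1 hp ε hε
  refine ⟨x, by simpa using hx, fun φ hφ => ?_⟩
  rw [dist_comm, dist_pi_lt_iff hε] at hd
  exact (dist_eq_norm (φ x) (f φ)) ▸ hd ⟨φ, hφ⟩

end WeakLimits

/-! ### Weakly compact operators -/

section WeaklyCompactOperators

variable {𝕜 : Type*} [RCLike 𝕜] {E : Type*} [NormedAddCommGroup E] [NormedSpace 𝕜 E]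
  {Y : Type*} [NormedAddCommGroup Y] [NormedSpace 𝕜 Y]

/-- Goldstine's theorem: each element of the unit ball of the double dual is the weak-star limit
of a net in the unit ball of the space. -/
theorem exists_net_tendsto_of_norm_le_one (f : StrongDual 𝕜 (StrongDual 𝕜 E)) (hf : ‖f‖ ≤ 1) :
    ∃ x : Finset (StrongDual 𝕜 E) × ℕ → E, (∀ i, ‖x i‖ ≤ 1) ∧
      ∀ φ : StrongDual 𝕜 E, Tendsto (fun i => φ (x i)) atTop (𝓝 (f φ)) := by
  classical
  choose x hx₁ hx₂ using fun i : Finset (StrongDual 𝕜 E) × ℕ =>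
    exists_mem_ball_forall_norm_sub_lt f hf i.1 (Nat.one_div_pos_of_nat (α := ℝ) (n := i.2))
  refine ⟨x, hx₁, fun φ => Metric.tendsto_atTop.2 fun ε hε => ?_⟩
  obtain ⟨N, hN⟩ := exists_nat_one_div_lt hε
  refine ⟨({φ}, N), fun i hi => ?_⟩
  rw [dist_eq_norm]
  refine (hx₂ i φ (hi.1 (Finset.mem_singleton_self φ))).trans (lt_of_le_of_lt ?_ hN)
  exact Nat.one_div_le_one_div hi.2

/-- The second adjoint of a weakly compact operator takes values in `Y`. -/
theorem IsWeaklyCompactOperator.exists_eq_comp {T : E →L[𝕜] Y} (hT : IsWeaklyCompactOperator T)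
    (f : StrongDual 𝕜 (StrongDual 𝕜 E)) : ∃ y : Y, ∀ g : StrongDual 𝕜 Y, f (g.comp T) = g y := by
  -- Goldstine's theorem concerns the unit ball, so `f` is rescaled
  wlog hf : ‖f‖ ≤ 1 generalizing f
  · have hf0 : (‖f‖ : 𝕜) ≠ 0 := by
      rintro h
      rw [RCLike.ofReal_eq_zero] at h
      exact hf (h ▸ zero_le_one)
    obtain ⟨y, hy⟩ := this ((‖f‖ : 𝕜)⁻¹ • f) (by
      refine (ContinuousLinearMap.opNorm_smul_le _ _).trans ?_
      rw [norm_inv, RCLike.norm_ofReal, abs_of_nonneg (norm_nonneg f)]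
      exact inv_mul_le_one)
    refine ⟨(‖f‖ : 𝕜) • y, fun g => ?_⟩
    rw [map_smul, ← hy g, smul_apply, smul_inv_smul₀ hf0]
  obtain ⟨x, hx, hxf⟩ := exists_net_tendsto_of_norm_le_one f hf
  classical
  let U : Ultrafilter (Finset (StrongDual 𝕜 E) × ℕ) := Ultrafilter.of atTop
  have hK : IsWeaklyCompact 𝕜 ((toWeakSpace 𝕜 Y ⁻¹'
      closure (toWeakSpace 𝕜 Y '' (T '' Metric.closedBall (0 : E) 1)))) := by
    rw [IsWeaklyCompact, image_preimage_eq _ (toWeakSpace 𝕜 Y).surjective]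
    exact hT
  obtain ⟨y, -, hy⟩ := hK.exists_tendstoWeakly U (x := fun i => T (x i))
    (Eventually.of_forall fun i => by
      refine mem_preimage.2 (subset_closure ⟨_, ⟨x i, by simpa using hx i, rfl⟩, rfl⟩))
  exact ⟨y, fun g =>
    tendsto_nhds_unique ((hxf (g.comp T)).mono_left (Ultrafilter.of_le _)) (hy g)⟩

/-- An operator whose second adjoint maps the unit ball into `Y` is weakly compact. -/
theorem isWeaklyCompactOperator_of_forall_norm_le_one {T : E →L[𝕜] Y}
    (h : ∀ f : StrongDual 𝕜 (StrongDual 𝕜 E), ‖f‖ ≤ 1 →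
      ∃ y : Y, ∀ g : StrongDual 𝕜 Y, f (g.comp T) = g y) :
    IsWeaklyCompactOperator T := by
  refine NormedSpace.isCompact_closure_of_isBounded 𝕜 Y _ ?_ ?_
  · rw [preimage_image_eq _ (toWeakSpace 𝕜 Y).injective]
    exact T.lipschitz.isBounded_image Metric.isBounded_closedBall
  · intro F hF
    obtain ⟨U, hU, hUF⟩ := mem_closure_iff_ultrafilter.1 hF
    -- lift the ultrafilter `U` to the unit ball of `E` and take the limit in the double dual of `E`
    have hex : ∀ G : WeakDual 𝕜 (StrongDual 𝕜 Y), ∃ x : E,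
        G ∈ NormedSpace.inclusionInDoubleDualWeak 𝕜 Y ''
          (toWeakSpace 𝕜 Y '' (T '' Metric.closedBall (0 : E) 1)) →
        ‖x‖ ≤ 1 ∧ ∀ g : StrongDual 𝕜 Y, g (T x) = G g := fun G => by
      by_cases hG : G ∈ NormedSpace.inclusionInDoubleDualWeak 𝕜 Y ''
          (toWeakSpace 𝕜 Y '' (T '' Metric.closedBall (0 : E) 1))
      · obtain ⟨_, ⟨_, ⟨x, hx, rfl⟩, rfl⟩, rfl⟩ := hG
        exact ⟨x, fun _ => ⟨by simpa using hx, fun g => rfl⟩⟩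
      · exact ⟨0, fun h => absurd h hG⟩
    choose σ hσ using hex
    obtain ⟨f, hf₁, hf⟩ := exists_weakStar_limit (𝕜 := 𝕜) U
      (fun G => NormedSpace.inclusionInDoubleDual 𝕜 E (σ G)) (C := 1)
      (mem_of_superset hU fun G hG =>
        (NormedSpace.double_dual_bound 𝕜 E _).trans (hσ G hG).1)
    obtain ⟨y, hy⟩ := h f hf₁
    refine ⟨toWeakSpace 𝕜 Y y, ?_⟩
    refine DFunLike.ext _ _ fun g => ?_
    have h₁ : Tendsto (fun G : WeakDual 𝕜 (StrongDual 𝕜 Y) => G g) U (𝓝 (F g)) :=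
      ((WeakDual.eval_continuous g).tendsto F).mono_left hUF
    have h₂ : Tendsto (fun G : WeakDual 𝕜 (StrongDual 𝕜 Y) => G g) U (𝓝 (g y)) := by
      rw [← hy g]
      exact (hf (g.comp T)).congr' (mem_of_superset hU fun G hG => (hσ G hG).2 g)
    exact tendsto_nhds_unique h₂ h₁

/-- A functional that is small on the common kernel of finitely many functionals is close to
their span. -/
theorem exists_norm_sub_sum_le {W ι : Type*} [NormedAddCommGroup W] [NormedSpace 𝕜 W] [Fintype ι]
    (F : StrongDual 𝕜 W) (L : ι → StrongDual 𝕜 W) {δ : ℝ} (hδ : 0 ≤ δ)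
    (h : ∀ w, (∀ i, L i w = 0) → ‖F w‖ ≤ δ * ‖w‖) :
    ∃ c : ι → 𝕜, ‖F - ∑ i, c i • L i‖ ≤ δ := by
  let N : Submodule 𝕜 W := ⨅ i, (L i : W →ₗ[𝕜] 𝕜).ker
  have hFN : ‖F.comp N.subtypeL‖ ≤ δ :=
    ContinuousLinearMap.opNorm_le_bound _ hδ fun w =>
      h w fun i => (Submodule.mem_iInf _).1 w.2 i
  obtain ⟨F', hF', hn⟩ := exists_extension_norm_eq N (F.comp N.subtypeL)
  have hspan : ((F - F' : StrongDual 𝕜 W) : W →ₗ[𝕜] 𝕜) ∈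
      Submodule.span 𝕜 (range fun i => (L i : W →ₗ[𝕜] 𝕜)) := by
    refine mem_span_of_iInf_ker_le_ker fun g hg => ?_
    have := hF' ⟨g, hg⟩
    simp [this]
  obtain ⟨c, hc⟩ := (Submodule.mem_span_range_iff_exists_fun 𝕜).1 hspan
  refine ⟨c, ?_⟩
  have : F - ∑ i, c i • L i = F' := by
    ext w
    have := LinearMap.congr_fun hc w
    simp only [LinearMap.sum_apply, LinearMap.smul_apply, ContinuousLinearMap.coe_coe] at this
    rw [sub_apply, sum_apply]
    simp only [smul_apply, this, sub_apply, sub_sub_cancel]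
  rw [this, hn]
  exact hFN

/-- An element of the double dual of a Banach space `Y` that is not an evaluation is bounded away
from zero on the unit balls of all annihilators of finite subsets of `Y`. -/
theorem exists_forall_finset_exists_apply_eq [CompleteSpace Y]
    (F : StrongDual 𝕜 (StrongDual 𝕜 Y)) (hF : ¬ ∃ y : Y, ∀ g : StrongDual 𝕜 Y, F g = g y) :
    ∃ ε > (0 : ℝ), ∀ s : Finset Y, ∃ g : StrongDual 𝕜 Y, ‖g‖ ≤ 1 ∧ (∀ y ∈ s, g y = 0) ∧
      F g = (ε : 𝕜) := by
  by_contra! hcon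
  refine hF ?_
  have hmem : F ∈ closure (range (NormedSpace.inclusionInDoubleDualLi 𝕜 (E := Y))) := by
    refine (SeminormedAddCommGroup.mem_closure_iff (E := StrongDual 𝕜 (StrongDual 𝕜 Y))).2
      fun ε hε => ?_
    obtain ⟨s, hs⟩ := hcon (ε / 2) (half_pos hε)
    obtain ⟨c, hc⟩ := exists_norm_sub_sum_le F
      (fun y : s => NormedSpace.inclusionInDoubleDual 𝕜 Y y.1) (half_pos hε).le fun g hg => by
        by_contra! hlt
        have h0 : ‖F g‖ ≠ 0 := fun h0 => by
          rw [h0] at hlt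
          exact absurd hlt (not_lt.2 (mul_nonneg (half_pos hε).le (norm_nonneg _)))
        refine hs (((ε / 2 : ℝ) : 𝕜) • (F g)⁻¹ • g) ?_ (fun y hy => ?_) ?_
        · refine (ContinuousLinearMap.opNorm_smul_le _ _).trans ?_
          refine (mul_le_mul_of_nonneg_left (ContinuousLinearMap.opNorm_smul_le _ _)
            (norm_nonneg _)).trans ?_
          rw [RCLike.norm_ofReal, abs_of_pos (half_pos hε), norm_inv, mul_left_comm,
            ← div_eq_inv_mul, div_le_one (by positivity)]
          exact hlt.le
        · have : g y = 0 := hg ⟨y, hy⟩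
          simp [this]
        · rw [map_smul, map_smul, smul_eq_mul, smul_eq_mul,
            inv_mul_cancel₀ (norm_ne_zero_iff.1 h0), mul_one]
    refine ⟨_, ⟨∑ y : s, c y • y.1, rfl⟩, lt_of_le_of_lt ?_ (half_lt_self hε)⟩
    have : NormedSpace.inclusionInDoubleDualLi 𝕜 (∑ y : s, c y • y.1) =
        ∑ y : s, c y • NormedSpace.inclusionInDoubleDual 𝕜 Y y.1 := by
      refine (map_sum (NormedSpace.inclusionInDoubleDual 𝕜 Y) _ _).trans ?_
      simp_rw [map_smul]
    rw [this]
    exact hc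
  have hclosed : IsClosed (range (NormedSpace.inclusionInDoubleDualLi 𝕜 (E := Y))) :=
    (NormedSpace.inclusionInDoubleDualLi 𝕜
      (E := Y)).isometry.isUniformInducing.isComplete_range.isClosed
  rw [hclosed.closure_eq] at hmem
  obtain ⟨y, rfl⟩ := hmem
  exact ⟨y, fun g => rfl⟩

end WeaklyCompactOperators

/-! ### The Eberlein–Šmulian theorem for sequences -/

section SequentialCompactness

variable {𝕜 : Type*} [RCLike 𝕜] {E : Type*} [NormedAddCommGroup E] [NormedSpace 𝕜 E]

/-- A closed subspace is closed under weak limits. -/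
theorem TendstoWeakly.mem_topologicalClosure {ι : Type*} {x : ι → E} {l : Filter ι} [l.NeBot]
    {a : E} (ha : TendstoWeakly 𝕜 x l a) {Z : Submodule 𝕜 E} (hx : ∀ i, x i ∈ Z) :
    a ∈ Z.topologicalClosure := by
  let : NormedSpace ℝ E := NormedSpace.restrictScalars ℝ 𝕜 E
  have : IsScalarTower ℝ 𝕜 E := ⟨fun r c x => by
    change (r • c) • x = (algebraMap ℝ 𝕜 r) • (c • x)
    rw [smul_smul, Algebra.smul_def]⟩
  exact ha.mem_closure (Z.restrictScalars ℝ).convex (Eventually.of_forall hx)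

/-- A separable subspace is separated by countably many functionals. -/
theorem exists_countable_functionals_separating {Z : Submodule 𝕜 E}
    (hZ : TopologicalSpace.IsSeparable (Z : Set E)) :
    ∃ g : ℕ → StrongDual 𝕜 E, ∀ z ∈ Z, (∀ n, g n z = 0) → z = 0 := by
  obtain ⟨c, hc, hZc⟩ := hZ
  rcases c.eq_empty_or_nonempty with rfl | hne
  · simp only [closure_empty, subset_empty_iff] at hZc
    exact ⟨0, fun z hz => absurd (hZc ▸ hz : z ∈ (∅ : Set E)) (notMem_empty z)⟩
  obtain ⟨d, rfl⟩ := hc.exists_eq_range hne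
  choose g hg₁ hg₂ using fun n => exists_dual_vector'' 𝕜 (d n)
  refine ⟨g, fun z hz h0 => ?_⟩
  rw [← norm_le_zero_iff]
  refine le_of_forall_pos_le_add fun ε hε => ?_
  obtain ⟨_, ⟨n, rfl⟩, hn⟩ := Metric.mem_closure_iff.1 (hZc hz) (ε / 2) (half_pos hε)
  rw [dist_eq_norm] at hn
  have h1 : ‖d n‖ ≤ ‖z - d n‖ := by
    have h2 : ‖g n (d n - z)‖ = ‖d n‖ := by
      rw [map_sub, h0 n, sub_zero, hg₂ n, RCLike.norm_ofReal, abs_norm]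
    rw [← h2, norm_sub_rev z]
    exact ((g n).le_of_opNorm_le (hg₁ n) _).trans_eq (one_mul _)
  have := norm_le_norm_sub_add z (d n)
  linarith

/-- The easy half of the Eberlein–Šmulian theorem: a bounded sequence all of whose ultrafilter
limits exist weakly has a weakly convergent subsequence. -/
theorem exists_subseq_tendstoWeakly (x : ℕ → E) {C : ℝ} (hC : ∀ n, ‖x n‖ ≤ C)
    (hx : ∀ U : Ultrafilter ℕ, ∃ a, TendstoWeakly 𝕜 x U a) :
    ∃ (θ : ℕ → ℕ) (a : E), StrictMono θ ∧ TendstoWeakly 𝕜 (x ∘ θ) atTop a := by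
  let Z := (Submodule.span 𝕜 (range x)).topologicalClosure
  have hZ : TopologicalSpace.IsSeparable (Z : Set E) := by
    rw [Submodule.topologicalClosure_coe]
    exact (countable_range x).isSeparable.span.closure
  obtain ⟨g, hg⟩ := exists_countable_functionals_separating hZ
  obtain ⟨b, -, θ, hθ, hb⟩ := (isCompact_univ_pi fun k : ℕ =>
    isCompact_closedBall (0 : 𝕜) (‖g k‖ * C)).tendsto_subseq (x := fun n k => g k (x n))
      (fun n k _ => by
        simpa using (g k).le_opNorm_of_le (hC n))
  rw [tendsto_pi_nhds] at hb
  have hlim : ∀ U : Ultrafilter ℕ, (U : Filter ℕ) ≤ atTop →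
      ∃ a ∈ Z, TendstoWeakly 𝕜 (x ∘ θ) U a ∧ ∀ k, g k a = b k := fun U hU => by
    obtain ⟨a, ha⟩ := hx (U.map θ)
    have ha' : TendstoWeakly 𝕜 (x ∘ θ) U a := ha.comp tendsto_map
    exact ⟨a, ha'.mem_topologicalClosure fun i => Submodule.subset_span ⟨_, rfl⟩, ha',
      fun k => tendsto_nhds_unique (ha' (g k)) ((hb k).mono_left hU)⟩
  obtain ⟨a, haZ, -, hak⟩ := hlim (hyperfilter ℕ) (by
    simpa [Nat.cofinite_eq_atTop] using Nat.hyperfilter_le_atTop)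
  refine ⟨θ, a, hθ, fun φ => (tendsto_iff_ultrafilter _ _ _).2 fun U hU => ?_⟩
  obtain ⟨a', haZ', ha', hak'⟩ := hlim U hU
  have : a' = a := sub_eq_zero.1 (hg _ (Z.sub_mem haZ' haZ) fun k => by simp [hak, hak'])
  exact this ▸ ha' φ

/-- A sequence in a weakly compact set has a subsequence converging weakly in that set. -/
theorem IsWeaklyCompact.exists_subseq {K : Set E} (hK : IsWeaklyCompact 𝕜 K) {x : ℕ → E}
    (hx : ∀ n, x n ∈ K) :
    ∃ (θ : ℕ → ℕ), ∃ a ∈ K, StrictMono θ ∧ TendstoWeakly 𝕜 (x ∘ θ) atTop a := by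
  obtain ⟨C, hC⟩ := hK.exists_norm_le
  obtain ⟨θ, a, hθ, ha⟩ := exists_subseq_tendstoWeakly (𝕜 := 𝕜) x (fun n => hC _ (hx n)) fun U =>
    (hK.exists_tendstoWeakly U (Eventually.of_forall hx)).imp fun a h => h.2
  obtain ⟨b, hb, hb'⟩ := hK.exists_tendstoWeakly (hyperfilter ℕ) (x := x ∘ θ)
    (Eventually.of_forall fun n => hx _)
  have : a = b := (ha.mono Nat.hyperfilter_le_atTop).unique hb'
  exact ⟨θ, a, this ▸ hb, hθ, ha⟩

end SequentialCompactness

/-! ### Absolutely convex hulls of weakly null sequences -/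

section AbsolutelyConvexHullOfNullSequence

open scoped ComplexOrder

variable {𝕜 : Type*} [RCLike 𝕜] {E : Type*} [NormedAddCommGroup E] [NormedSpace 𝕜 E]

theorem norm_add_norm_eq_one_of_nonneg {α β : 𝕜} (hα : 0 ≤ α) (hβ : 0 ≤ β) (hαβ : α + β = 1) :
    ‖α‖ + ‖β‖ = 1 := by
  have : ((‖α‖ + ‖β‖ : ℝ) : 𝕜) = ((1 : ℝ) : 𝕜) := by
    rw [RCLike.ofReal_add, RCLike.norm_of_nonneg' hα, RCLike.norm_of_nonneg' hβ, hαβ,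
      RCLike.ofReal_one]
  exact RCLike.ofReal_injective this

variable (𝕜) in
/-- The closed unit ball of `ℓ¹`, as a subset of the product space. -/
def summableUnitBall : Set (ℕ → 𝕜) := {a | ∀ s : Finset ℕ, ∑ i ∈ s, ‖a i‖ ≤ 1}

theorem isCompact_summableUnitBall : IsCompact (summableUnitBall 𝕜) := by
  refine (isCompact_univ_pi fun _ : ℕ => isCompact_closedBall (0 : 𝕜) 1).of_isClosed_subset ?_ ?_
  · simp only [summableUnitBall, ofPred_forall]
    exact isClosed_iInter fun s => isClosed_le (by fun_prop) continuous_const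
  · intro a ha i _
    simpa using ha {i}

theorem summable_norm_of_mem {a : ℕ → 𝕜} (ha : a ∈ summableUnitBall 𝕜) :
    Summable fun i => ‖a i‖ :=
  summable_of_sum_le (fun _ => norm_nonneg _) ha

theorem summable_smul_of_mem [CompleteSpace E] {z : ℕ → E} {C : ℝ} (hz : ∀ n, ‖z n‖ ≤ C)
    {a : ℕ → 𝕜} (ha : a ∈ summableUnitBall 𝕜) : Summable fun i => a i • z i := by
  refine ((summable_norm_of_mem ha).mul_right C).of_norm_bounded fun i => ?_
  rw [norm_smul]
  exact mul_le_mul_of_nonneg_left (hz i) (norm_nonneg _)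

theorem continuousOn_tsum_mul {c : ℕ → 𝕜} (hc : Tendsto c atTop (𝓝 0)) :
    ContinuousOn (fun a : ℕ → 𝕜 => ∑' i, a i * c i) (summableUnitBall 𝕜) := by
  obtain ⟨C, hC⟩ := (Metric.isBounded_range_of_tendsto _ hc).exists_norm_le
  have hC' : ∀ n, ‖c n‖ ≤ C := fun n => hC _ ⟨n, rfl⟩
  have hu : TendstoUniformlyOn (fun (N : ℕ) (a : ℕ → 𝕜) => ∑ i ∈ Finset.range N, a i * c i)
      (fun a => ∑' i, a i * c i) atTop (summableUnitBall 𝕜) := by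
    refine Metric.tendstoUniformlyOn_iff.2 fun ε hε => ?_
    obtain ⟨N₀, hN₀⟩ := Metric.tendsto_atTop.1 hc (ε / 2) (half_pos hε)
    filter_upwards [eventually_ge_atTop N₀] with N hN a ha
    have hs : Summable fun i => a i * c i := by
      simpa only [smul_eq_mul] using summable_smul_of_mem (E := 𝕜) hC' ha
    have ht : Summable fun i => ‖a (i + N)‖ :=
      (summable_nat_add_iff (f := fun i => ‖a i‖) N).2 (summable_norm_of_mem ha)
    rw [dist_eq_norm, ← hs.sum_add_tsum_nat_add N, add_sub_cancel_left]
    have hle : ‖∑' i, a (i + N) * c (i + N)‖ ≤ ∑' i, ‖a (i + N)‖ * (ε / 2) := by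
      refine tsum_of_norm_bounded (ht.mul_right _).hasSum fun i => ?_
      rw [norm_mul]
      refine mul_le_mul_of_nonneg_left ?_ (norm_nonneg _)
      simpa using (hN₀ (i + N) (by omega)).le
    have h1 : ∑' i, ‖a (i + N)‖ ≤ 1 := by
      refine ht.tsum_le_of_sum_le fun s => ?_
      simpa using ha (s.map (addRightEmbedding N))
    rw [tsum_mul_right] at hle
    nlinarith
  exact hu.continuousOn (Frequently.of_forall fun N => by fun_prop)

/-- In a Banach space, a weakly null sequence lies in a weakly compact absolutely convex set: the
image of the unit ball of `ℓ¹` under `a ↦ ∑ aᵢ zᵢ`. -/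
theorem TendstoWeakly.exists_weaklyCompactDisc [CompleteSpace E] {z : ℕ → E}
    (hz : TendstoWeakly 𝕜 z atTop 0) : ∃ K ∈ weaklyCompactDiscs 𝕜 E, ∀ n, z n ∈ K := by
  obtain ⟨C, hC⟩ := hz.exists_norm_le
  have hs : ∀ a ∈ summableUnitBall 𝕜, Summable fun i => a i • z i :=
    fun a ha => summable_smul_of_mem hC ha
  refine ⟨(fun a : ℕ → 𝕜 => ∑' i, a i • z i) '' summableUnitBall 𝕜, ⟨?_, ?_, ?_⟩, fun n => ?_⟩
  · rw [IsWeaklyCompact, image_image]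
    refine isCompact_summableUnitBall.image_of_continuousOn fun a ha => ?_
    refine tendsto_toWeakSpace_iff.2 fun φ => ?_
    have hφ : ∀ b ∈ summableUnitBall 𝕜, φ (∑' i, b i • z i) = ∑' i, b i * φ (z i) :=
      fun b hb => by simp [φ.map_tsum (hs b hb)]
    rw [hφ a ha]
    have hφz : Tendsto (fun n => φ (z n)) atTop (𝓝 0) := by simpa using hz φ
    refine (continuousOn_tsum_mul hφz a ha).congr' ?_
    filter_upwards [self_mem_nhdsWithin] with b hb
    exact (hφ b hb).symm
  · rintro c hc _ ⟨_, ⟨a, ha, rfl⟩, rfl⟩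
    refine ⟨c • a, fun s => ?_, ?_⟩
    · simp only [Pi.smul_apply, norm_smul, ← Finset.mul_sum]
      exact mul_le_one₀ hc (Finset.sum_nonneg fun _ _ => norm_nonneg _) (ha s)
    · simp only [Pi.smul_apply, smul_assoc]
      exact (hs a ha).tsum_const_smul c
  · rintro _ ⟨a, ha, rfl⟩ _ ⟨b, hb, rfl⟩ α β hα hβ hαβ
    have hnorm := norm_add_norm_eq_one_of_nonneg hα hβ hαβ
    refine ⟨α • a + β • b, fun s => ?_, ?_⟩
    · calc ∑ i ∈ s, ‖(α • a + β • b) i‖ ≤ ∑ i ∈ s, (‖α‖ * ‖a i‖ + ‖β‖ * ‖b i‖) :=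
            Finset.sum_le_sum fun i _ => (norm_add_le _ _).trans (by simp)
        _ = ‖α‖ * ∑ i ∈ s, ‖a i‖ + ‖β‖ * ∑ i ∈ s, ‖b i‖ := by
            rw [Finset.sum_add_distrib, Finset.mul_sum, Finset.mul_sum]
        _ ≤ ‖α‖ * 1 + ‖β‖ * 1 := by gcongr <;> [exact ha s; exact hb s]
        _ = 1 := by rw [mul_one, mul_one, hnorm]
    · simp only [Pi.add_apply, Pi.smul_apply, add_smul, smul_assoc]
      rw [((hs a ha).const_smul α).tsum_add ((hs b hb).const_smul β), (hs a ha).tsum_const_smul,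
        (hs b hb).tsum_const_smul]
  · refine ⟨Pi.single n 1, fun s => ?_, ?_⟩
    · calc ∑ i ∈ s, ‖(Pi.single n 1 : ℕ → 𝕜) i‖ = ∑ i ∈ s, if i = n then 1 else 0 :=
            Finset.sum_congr rfl fun i _ => by rw [Pi.single_apply]; split_ifs <;> simp
        _ ≤ 1 := by rw [Finset.sum_ite_eq']; split_ifs <;> norm_num
    · refine (tsum_eq_single n fun i hi => ?_).trans ?_
      · rw [Pi.single_eq_of_ne hi, zero_smul]
      · rw [Pi.single_eq_same, one_smul]

end AbsolutelyConvexHullOfNullSequence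

/-! ### The Mackey topology -/

section MackeyTopology

open scoped ComplexOrder

variable {𝕜 : Type*} [RCLike 𝕜] {X : Type*} [NormedAddCommGroup X] [NormedSpace 𝕜 X]

theorem mem_nhds_zero_mackeyTopology {K : Set X} (hK : K ∈ weaklyCompactDiscs 𝕜 X) {ε : ℝ}
    (hε : 0 < ε) :
    {φ : StrongDual 𝕜 X | ∀ x ∈ K, ‖φ x‖ < ε} ∈ @nhds _ (mackeyTopology 𝕜 X) 0 := by
  have := UniformConvergenceCLM.eventually_nhds_zero_mapsTo (RingHom.id 𝕜) (F := 𝕜) hK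
    (Metric.ball_mem_nhds 0 hε)
  exact mem_of_superset this fun φ hφ x hx => mem_ball_zero_iff.1 (hφ hx)

theorem tendsto_mackeyTopology_zero_iff {ι : Type*} {l : Filter ι} {y : ι → StrongDual 𝕜 X} :
    Tendsto y l (@nhds _ (mackeyTopology 𝕜 X) 0) ↔
      ∀ K ∈ weaklyCompactDiscs 𝕜 X, ∀ ε > 0, ∀ᶠ i in l, ∀ x ∈ K, ‖y i x‖ < ε := by
  refine ⟨fun h K hK ε hε => h (mem_nhds_zero_mackeyTopology hK hε), fun h => ?_⟩
  have hb := UniformConvergenceCLM.nhds_zero_eq_of_basis (RingHom.id 𝕜) 𝕜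
    (weaklyCompactDiscs 𝕜 X) (Metric.nhds_basis_ball (x := (0 : 𝕜)))
  change Tendsto y l (@nhds (UniformConvergenceCLM (RingHom.id 𝕜) 𝕜 (weaklyCompactDiscs 𝕜 X)) _ 0)
  rw [hb]
  refine tendsto_iInf.2 fun K => tendsto_iInf.2 fun hK => tendsto_iInf.2 fun ε =>
    tendsto_iInf.2 fun hε => tendsto_principal.2 ?_
  filter_upwards [h K hK ε hε] with i hi x hx
  exact mem_ball_zero_iff.2 (hi x hx)

theorem tendsto_nhds_iff_sub {E : Type*} [AddCommGroup E] {t : TopologicalSpace E}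
    (ht : @IsTopologicalAddGroup E t _) {ι : Type*} {l : Filter ι} {y : ι → E} {a : E} :
    Tendsto y l (@nhds E t a) ↔ Tendsto (fun i => y i - a) l (@nhds E t 0) :=
  tendsto_sub_nhds_zero_iff.symm

theorem exists_mem_weaklyCompactDiscs [CompleteSpace X] (x : X) :
    ∃ K ∈ weaklyCompactDiscs 𝕜 X, x ∈ K := by
  have h : TendstoWeakly 𝕜 (fun n : ℕ => if n = 0 then x else 0) atTop 0 := fun φ =>
    tendsto_const_nhds.congr' (by
      filter_upwards [eventually_ne_atTop 0] with n hn
      simp [hn])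
  obtain ⟨K, hK, hx⟩ := h.exists_weaklyCompactDisc
  exact ⟨K, hK, by simpa using hx 0⟩

theorem tendsto_apply_of_tendsto_mackeyTopology [CompleteSpace X] {ι : Type*} {l : Filter ι}
    {y : ι → StrongDual 𝕜 X} {a : StrongDual 𝕜 X}
    (h : Tendsto y l (@nhds _ (mackeyTopology 𝕜 X) a)) (x : X) :
    Tendsto (fun i => y i x) l (𝓝 (a x)) := by
  obtain ⟨K, hK, hx⟩ := exists_mem_weaklyCompactDiscs (𝕜 := 𝕜) x
  rw [tendsto_nhds_iff_sub (isLocallyConvexTopology_mackeyTopology 𝕜 X).1,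
    tendsto_mackeyTopology_zero_iff] at h
  rw [← tendsto_sub_nhds_zero_iff, Metric.tendsto_nhds]
  intro ε hε
  filter_upwards [h K hK ε hε] with i hi
  rw [dist_zero_right]
  exact hi x hx

/-- The elements of a weakly compact disc are bounded, so the Mackey topology is coarser than the
norm topology. -/
theorem tendsto_mackeyTopology_zero_of_norm {ι : Type*} {l : Filter ι} {y : ι → StrongDual 𝕜 X}
    (h : Tendsto (fun i => ‖y i‖) l (𝓝 0)) : Tendsto y l (@nhds _ (mackeyTopology 𝕜 X) 0) := by
  refine tendsto_mackeyTopology_zero_iff.2 fun K hK ε hε => ?_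
  obtain ⟨C, hC⟩ := hK.1.exists_norm_le
  have hC' : 0 < max C 1 := lt_max_of_lt_right one_pos
  filter_upwards [h.eventually_lt_const (div_pos hε hC')] with i hi x hx
  calc ‖y i x‖ ≤ ‖y i‖ * max C 1 := (y i).le_opNorm_of_le ((hC x hx).trans (le_max_left _ _))
    _ < ε := (lt_div_iff₀ hC').1 hi

theorem IsPrecompactFor.exists_norm_le [CompleteSpace X] {A : Set (StrongDual 𝕜 X)}
    (hA : IsPrecompactFor (mackeyTopology 𝕜 X) A) : ∃ C, ∀ y ∈ A, ‖y‖ ≤ C := by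
  obtain ⟨C, hC⟩ := banach_steinhaus (g := fun y : A => (y : StrongDual 𝕜 X)) fun x => by
    obtain ⟨K, hK, hx⟩ := exists_mem_weaklyCompactDiscs (𝕜 := 𝕜) x
    obtain ⟨F, hF, hAF⟩ := hA _ (mem_nhds_zero_mackeyTopology hK one_pos)
    obtain ⟨C, hC⟩ := (hF.image fun y : StrongDual 𝕜 X => y x).isBounded.exists_norm_le
    refine ⟨C + 1, fun y => ?_⟩
    obtain ⟨b, hb, u, hu, hy⟩ := hAF y.2
    rw [← hy]
    exact (norm_add_le _ _).trans (add_le_add (hC _ ⟨b, hb, rfl⟩) (hu x hx).le)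
  exact ⟨C, fun y hy => hC ⟨y, hy⟩⟩

/-- Weakly null sequences of `X` converge to zero uniformly on the sets that are precompact for
the Mackey topology. -/
theorem IsPrecompactFor.eventually_norm_lt [CompleteSpace X] {A : Set (StrongDual 𝕜 X)}
    (hA : IsPrecompactFor (mackeyTopology 𝕜 X) A) {z : ℕ → X} (hz : TendstoWeakly 𝕜 z atTop 0)
    {ε : ℝ} (hε : 0 < ε) : ∀ᶠ n in atTop, ∀ y ∈ A, ‖y (z n)‖ < ε := by
  obtain ⟨K, hK, hzK⟩ := hz.exists_weaklyCompactDisc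
  obtain ⟨F, hF, hAF⟩ := hA _ (mem_nhds_zero_mackeyTopology hK (half_pos hε))
  have hev : ∀ᶠ n in atTop, ∀ b ∈ F, ‖b (z n)‖ < ε / 2 :=
    (eventually_all_finite hF).2 fun b _ => by
      have := (hz b).norm
      rw [map_zero, norm_zero] at this
      exact this.eventually_lt_const (half_pos hε)
  filter_upwards [hev] with n hn y hy
  obtain ⟨b, hb, u, hu, rfl⟩ := hAF hy
  calc ‖(b + u) (z n)‖ ≤ ‖b (z n)‖ + ‖u (z n)‖ := norm_add_le _ _
    _ < ε / 2 + ε / 2 := add_lt_add (hn b hb) (hu _ (hzK n))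
    _ = ε := add_halves ε

end MackeyTopology

/-! ### Rosenthal's dichotomy -/

section RosenthalDichotomy

theorem exists_seq_of_forall_exists_step {σ : Type*} (P : σ → Prop) (R : ℕ → σ → σ → Prop)
    (h : ∀ k s, P s → ∃ s', P s' ∧ R k s s') {s₀ : σ} (h₀ : P s₀) :
    ∃ u : ℕ → σ, u 0 = s₀ ∧ ∀ k, P (u k) ∧ R k (u k) (u (k + 1)) := by
  choose! next hP hR using h
  let u : ℕ → σ := fun k => Nat.rec s₀ (fun k s => next k s) k
  have hu : ∀ k, P (u k) := fun k => by
    induction k with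
    | zero => exact h₀
    | succ k ih => exact hP k _ ih
  exact ⟨u, rfl, fun k => ⟨hu k, hR k _ (hu k)⟩⟩

variable {α : Type*} {C : Bool → ℕ → Set α}

/-- The point `x` lies in infinitely many `C true n` and in infinitely many `C false n` with
`n ∈ M`. -/
def OscillatesOn (C : Bool → ℕ → Set α) (M : Set ℕ) (x : α) : Prop :=
  ∀ b, {n ∈ M | x ∈ C b n}.Infinite

/-- Each infinite subset of `M` has a point of `S` that oscillates on it. -/
def OscillatesHereditarily (C : Bool → ℕ → Set α) (S : Set α) (M : Set ℕ) : Prop :=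
  ∀ M' ⊆ M, M'.Infinite → ∃ x ∈ S, OscillatesOn C M' x

theorem OscillatesOn.mono_of_diff {M M' : Set ℕ} {x : α} (h : OscillatesOn C M x) (k : ℕ)
    (hM : M ∩ Ioi k ⊆ M') : OscillatesOn C M' x := fun b =>
  ((h b).sdiff (finite_Iic k)).mono fun _ hn => ⟨hM ⟨hn.1.1, not_le.1 fun h => hn.2 (mem_Iic.2 h)⟩, hn.1.2⟩

theorem infinite_inter_Ioi {M : Set ℕ} (hM : M.Infinite) (n : ℕ) : (M ∩ Ioi n).Infinite :=
  (hM.sdiff (finite_Iic n)).mono fun _ hm => ⟨hm.1, not_le.1 fun h => hm.2 (mem_Iic.2 h)⟩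

/-- The terms chosen successively from a decreasing sequence of sets of naturals increase, and
each tail of them lies in the corresponding set. -/
theorem strictMono_and_mem_of_subset_inter_Ioi {M : ℕ → Set ℕ} {n : ℕ → ℕ}
    (hn : ∀ k, n k ∈ M k) (hM : ∀ k, M (k + 1) ⊆ M k ∩ Ioi (n k)) :
    StrictMono n ∧ Antitone M :=
  ⟨strictMono_nat_of_lt_succ fun k => (hM k (hn (k + 1))).2,
    antitone_nat_of_succ_le fun k => (hM k).trans inter_subset_left⟩

/-- Splitting step: if finitely many sets oscillate hereditarily on `M`, then for some `n ∈ M` all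
their intersections with `C true n` and with `C false n` do so on a common infinite subset. -/
theorem exists_oscillatesHereditarily_inter {𝒮 : Set (Set α)} (h𝒮 : 𝒮.Finite) {M : Set ℕ}
    (hM : M.Infinite) (h : ∀ S ∈ 𝒮, OscillatesHereditarily C S M) :
    ∃ n ∈ M, ∃ M' ⊆ M ∩ Ioi n, M'.Infinite ∧
      ∀ S ∈ 𝒮, ∀ b, OscillatesHereditarily C (S ∩ C b n) M' := by
  by_contra! hcon
  have hstep : ∀ (k : ℕ) (M₁ : Set ℕ), (M₁ ⊆ M ∧ M₁.Infinite) → ∃ M₂ : Set ℕ,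
      (M₂ ⊆ M ∧ M₂.Infinite) ∧ ∃ n ∈ M₁, M₂ ⊆ M₁ ∩ Ioi n ∧ ∃ c : 𝒮 × Bool,
        ∀ x ∈ c.1.1 ∩ C c.2 n, ¬ OscillatesOn C M₂ x := by
    rintro - M₁ ⟨hM₁, hinf⟩
    obtain ⟨n, hn⟩ := hinf.nonempty
    obtain ⟨S, hS, b, hb⟩ := hcon n (hM₁ hn) (M₁ ∩ Ioi n) (inter_subset_inter_left _ hM₁)
      (infinite_inter_Ioi hinf n)
    simp only [OscillatesHereditarily, not_forall, not_exists, not_and] at hb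
    obtain ⟨M₂, hM₂, hinf₂, hx⟩ := hb
    exact ⟨M₂, ⟨hM₂.trans (inter_subset_left.trans hM₁), hinf₂⟩, n, hn, hM₂, (⟨S, hS⟩, b), hx⟩
  obtain ⟨u, -, hu⟩ := exists_seq_of_forall_exists_step _ _ hstep ⟨Subset.rfl, hM⟩
  choose hP n hn hsub c hc using hu
  obtain ⟨hmono, hanti⟩ := strictMono_and_mem_of_subset_inter_Ioi hn hsub
  have : Finite 𝒮 := h𝒮
  obtain ⟨d, hd⟩ := Finite.exists_infinite_fiber c
  rw [infinite_coe_iff] at hd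
  obtain ⟨x, hxS, hx⟩ := h d.1 d.1.2 (n '' (c ⁻¹' {d}))
    (image_subset_iff.2 fun k _ => (hP k).1 (hn k)) (hd.image hmono.injective.injOn)
  obtain ⟨_, ⟨k, hk, rfl⟩, hxk⟩ := (hx d.2).nonempty
  refine hc k x ?_ (hx.mono_of_diff (n k) ?_)
  · rw [mem_singleton_iff.1 hk]
    exact ⟨hxS, hxk⟩
  · rintro _ ⟨⟨j, -, rfl⟩, hj⟩
    exact hanti (Nat.succ_le_of_lt (hmono.lt_iff_lt.1 hj)) (hn j)

/-- Hereditary oscillation yields a Boolean independent subsequence. -/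
theorem OscillatesHereditarily.exists_independent {M : Set ℕ} (hM : M.Infinite)
    (h : OscillatesHereditarily C univ M) :
    ∃ θ : ℕ → ℕ, StrictMono θ ∧ ∀ (ω : ℕ → Bool) (N : ℕ), ∃ x, ∀ i < N, x ∈ C (ω i) (θ i) := by
  have hstep : ∀ (k : ℕ) (p : Set (Set α) × Set ℕ),
      (p.1.Finite ∧ p.2.Infinite ∧ ∀ S ∈ p.1, OscillatesHereditarily C S p.2) →
      ∃ p' : Set (Set α) × Set ℕ,
        (p'.1.Finite ∧ p'.2.Infinite ∧ ∀ S ∈ p'.1, OscillatesHereditarily C S p'.2) ∧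
        ∃ n ∈ p.2, p'.2 ⊆ p.2 ∩ Ioi n ∧ ∀ S ∈ p.1, ∀ b, S ∩ C b n ∈ p'.1 := by
    rintro - ⟨𝒮, M₁⟩ ⟨hfin, hinf, hosc⟩
    obtain ⟨n, hn, M₂, hM₂, hinf₂, hosc₂⟩ := exists_oscillatesHereditarily_inter hfin hinf hosc
    refine ⟨(⋃ b, (fun S => S ∩ C b n) '' 𝒮, M₂), ⟨finite_iUnion fun b => hfin.image _, hinf₂, ?_⟩,
      n, hn, hM₂, fun S hS b => mem_iUnion.2 ⟨b, S, hS, rfl⟩⟩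
    intro T hT
    obtain ⟨b, S, hS, rfl⟩ := mem_iUnion.1 hT
    exact hosc₂ S hS b
  obtain ⟨u, hu₀, hu⟩ := exists_seq_of_forall_exists_step _ _ hstep
    (s₀ := ({univ}, M)) ⟨finite_singleton _, hM, by simpa using h⟩
  choose hP n hn hsub hmem using hu
  refine ⟨n, (strictMono_and_mem_of_subset_inter_Ioi hn hsub).1, fun ω N => ?_⟩
  have hω : {x | ∀ i < N, x ∈ C (ω i) (n i)} ∈ (u N).1 := by
    induction N with
    | zero => simp [hu₀]
    | succ N ih =>
      convert hmem N _ ih (ω N) using 1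
      ext x
      exact Nat.forall_lt_succ_right
  obtain ⟨x, hx, -⟩ := (hP N).2.2 _ hω _ Subset.rfl (hP N).2.1
  exact ⟨x, hx⟩

/-- Rosenthal's dichotomy: a pointwise bounded sequence of real functions has a pointwise
convergent subsequence, or a subsequence whose sublevel sets `{f < r}` and superlevel sets
`{s < f}`, for some `r < s`, are Boolean independent. -/
theorem exists_subseq_tendsto_or_independent (f : ℕ → α → ℝ)
    (hf : ∀ x, ∃ B, ∀ n, |f n x| ≤ B) :
    (∃ θ : ℕ → ℕ, StrictMono θ ∧ ∀ x, ∃ l, Tendsto (fun n => f (θ n) x) atTop (𝓝 l)) ∨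
    ∃ r s : ℝ, r < s ∧ ∃ θ : ℕ → ℕ, StrictMono θ ∧ ∀ (ω : ℕ → Bool) (N : ℕ), ∃ x, ∀ i < N,
      if ω i then s < f (θ i) x else f (θ i) x < r := by
  let D : ℚ × ℚ → Bool → ℕ → Set α := fun q b n =>
    {x | if b then (q.2 : ℝ) < f n x else f n x < q.1}
  by_cases hind : ∃ q : ℚ × ℚ, q.1 < q.2 ∧ ∃ M : Set ℕ, M.Infinite ∧
      OscillatesHereditarily (D q) univ M
  · obtain ⟨q, hq, M, hM, h⟩ := hind
    exact Or.inr ⟨q.1, q.2, by exact_mod_cast hq, h.exists_independent hM⟩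
  push Not at hind
  left
  obtain ⟨e, he⟩ := exists_surjective_nat (ℚ × ℚ)
  have hstep : ∀ (k : ℕ) (M₁ : Set ℕ), M₁.Infinite → ∃ M₂ : Set ℕ, M₂.Infinite ∧
      ∃ n ∈ M₁, M₂ ⊆ M₁ ∩ Ioi n ∧ ((e k).1 < (e k).2 → ∀ x, ¬ OscillatesOn (D (e k)) M₂ x) := by
    intro k M₁ hinf
    obtain ⟨n, hn⟩ := hinf.nonempty
    by_cases hk : (e k).1 < (e k).2
    · have := hind _ hk _ (infinite_inter_Ioi hinf n)
      simp only [OscillatesHereditarily, not_forall, not_exists, not_and] at this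
      obtain ⟨M₂, hM₂, hinf₂, hx⟩ := this
      exact ⟨M₂, hinf₂, n, hn, hM₂, fun _ x => hx x (mem_univ x)⟩
    · exact ⟨_, infinite_inter_Ioi hinf n, n, hn, Subset.rfl, fun h => absurd h hk⟩
  obtain ⟨u, -, hu⟩ := exists_seq_of_forall_exists_step _ _ hstep infinite_univ
  choose hP n hn hsub hosc using hu
  obtain ⟨hmono, hanti⟩ := strictMono_and_mem_of_subset_inter_Ioi hn hsub
  refine ⟨n, hmono, fun x => ?_⟩
  obtain ⟨B, hB⟩ := hf x
  refine tendsto_of_no_upcrossings Rat.denseRange_cast ?_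
    (isBoundedUnder_of ⟨B, fun k => (abs_le.1 (hB _)).2⟩)
    (isBoundedUnder_of ⟨-B, fun k => (abs_le.1 (hB _)).1⟩)
  rintro _ ⟨r, rfl⟩ _ ⟨s, rfl⟩ hrs ⟨hr, hs⟩
  obtain ⟨k, hk⟩ := he (r, s)
  have hrs' : (e k).1 < (e k).2 := by
    rw [hk]
    exact_mod_cast hrs
  refine hosc k hrs' x fun b => ?_
  have key : ∃ᶠ j in atTop, x ∈ D (e k) b (n j) := by
    rw [hk]
    cases b
    · simpa [D] using hr
    · simpa [D] using hs
  have hJ : {j | x ∈ D (e k) b (n j)}.Infinite := Nat.frequently_atTop_iff_infinite.1 key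
  refine ((infinite_inter_Ioi hJ k).image hmono.injective.injOn).mono ?_
  rintro _ ⟨j, ⟨hj, hkj⟩, rfl⟩
  exact ⟨hanti (Nat.succ_le_of_lt hkj) (hn j), hj⟩

end RosenthalDichotomy

/-! ### Separating independent sequences by a measure -/

section LimitMeasure

open MeasureTheory CompactlySupported

/-- A limit of positive functionals of norm at most one on `C(K, ℝ)` along an ultrafilter is
integration against a finite measure. -/
theorem exists_measure_tendsto_integral {K ι : Type*} [TopologicalSpace K] [CompactSpace K]
    [T2Space K] [MeasurableSpace K] [BorelSpace K] (U : Ultrafilter ι)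
    (Λ : ι → C(K, ℝ) →ₗ[ℝ] ℝ) (hpos : ∀ i g, 0 ≤ g → 0 ≤ Λ i g) (hle : ∀ i g, |Λ i g| ≤ ‖g‖) :
    ∃ μ : Measure K, IsFiniteMeasure μ ∧
      ∀ g : C(K, ℝ), Tendsto (fun i => Λ i g) U (𝓝 (∫ x, g x ∂μ)) := by
  have hlim : ∀ g : C(K, ℝ), ∃ l, Tendsto (fun i => Λ i g) U (𝓝 l) := fun g => by
    obtain ⟨l, -, hl⟩ := (isCompact_closedBall (0 : ℝ) ‖g‖).ultrafilter_le_nhds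
      (U.map fun i => Λ i g) (le_principal_iff.2 (mem_map.2 (Eventually.of_forall fun i => by
        simpa using hle i g)))
    exact ⟨l, hl⟩
  choose L hL using hlim
  let Λ₀ : C_c(K, ℝ) →ₗ[ℝ] ℝ :=
    { toFun := fun g => L g.toContinuousMap
      map_add' := fun g h => tendsto_nhds_unique (hL _)
        (((hL g.toContinuousMap).add (hL h.toContinuousMap)).congr fun i => ((Λ i).map_add _ _).symm)
      map_smul' := fun c g => tendsto_nhds_unique (hL _)
        (((hL g.toContinuousMap).const_smul c).congr fun i => ((Λ i).map_smul _ _).symm) }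
  let Λ' : C_c(K, ℝ) →ₚ[ℝ] ℝ := PositiveLinearMap.mk₀ Λ₀ fun g hg =>
    ge_of_tendsto' (hL g.toContinuousMap) fun i => hpos i _ fun x => hg x
  refine ⟨RealRMK.rieszMeasure Λ', inferInstance, fun g => ?_⟩
  have := RealRMK.integral_rieszMeasure Λ' (CompactlySupportedContinuousMap.continuousMapEquiv g)
  change ∫ x, g x ∂_ = L g at this
  rw [this]
  exact hL g

/-- The average of the values at finitely many points of a compact space. -/
noncomputable def pointAverage {K Ω : Type*} [TopologicalSpace K] [Fintype Ω]
    (x : Ω → K) : C(K, ℝ) →ₗ[ℝ] ℝ where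
  toFun g := (Fintype.card Ω : ℝ)⁻¹ * ∑ ω, g (x ω)
  map_add' g h := by simp [Finset.sum_add_distrib, mul_add]
  map_smul' c g := by simp [← Finset.mul_sum, mul_left_comm]

theorem pointAverage_nonneg {K Ω : Type*} [TopologicalSpace K] [Fintype Ω] (x : Ω → K)
    (g : C(K, ℝ)) (hg : 0 ≤ g) : 0 ≤ pointAverage x g :=
  mul_nonneg (by positivity) (Finset.sum_nonneg fun ω _ => hg (x ω))

theorem abs_pointAverage_le {K Ω : Type*} [TopologicalSpace K] [CompactSpace K] [Fintype Ω]
    (x : Ω → K) (g : C(K, ℝ)) : |pointAverage x g| ≤ ‖g‖ := by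
  have h : |∑ ω, g (x ω)| ≤ Fintype.card Ω * ‖g‖ := by
    refine (Finset.abs_sum_le_sum_abs _ _).trans ?_
    refine (Finset.sum_le_card_nsmul _ _ ‖g‖ fun ω _ => ?_).trans (by simp)
    exact g.norm_coe_le_norm (x ω)
  change |(Fintype.card Ω : ℝ)⁻¹ * ∑ ω, g (x ω)| ≤ ‖g‖
  rw [abs_mul, abs_of_nonneg (by positivity : (0 : ℝ) ≤ (Fintype.card Ω : ℝ)⁻¹)]
  rcases Nat.eq_zero_or_pos (Fintype.card Ω) with h0 | h0
  · simp [h0]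
  · rw [inv_mul_le_iff₀ (by exact_mod_cast h0)]
    exact h

/-- A function on the sign vectors that is at least `c` wherever the coordinates `i` and `j` differ
has average at least `c / 2`. -/
theorem half_le_pointAverage {K : Type*} [TopologicalSpace K] {N : ℕ} (x : (Fin N → Bool) → K)
    (g : C(K, ℝ)) (hg : 0 ≤ g) {c : ℝ} {i j : Fin N} (hij : i ≠ j)
    (h : ∀ ω : Fin N → Bool, ω i ≠ ω j → c ≤ g (x ω)) : c / 2 ≤ pointAverage x g := by
  classical
  -- for each `ω`, the coordinates `i`, `j` differ in `ω` or in its flip at `i`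
  have hflip : Function.Involutive fun ω : Fin N → Bool => Function.update ω i (!ω i) := fun ω => by
    simp
  have hsum : ∑ ω : Fin N → Bool, g (x (Function.update ω i (!ω i))) = ∑ ω, g (x ω) :=
    Equiv.sum_comp hflip.toPerm fun ω => g (x ω)
  have hle : Fintype.card (Fin N → Bool) * c ≤ 2 * ∑ ω, g (x ω) := by
    calc Fintype.card (Fin N → Bool) * c = ∑ ω : Fin N → Bool, c := by simp
      _ ≤ ∑ ω, (g (x ω) + g (x (Function.update ω i (!ω i)))) := by
          refine Finset.sum_le_sum fun ω _ => ?_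
          have h₁ : 0 ≤ g (x ω) := hg _
          have h₂ : 0 ≤ g (x (Function.update ω i (!ω i))) := hg _
          by_cases hω : ω i = ω j
          · have := h (Function.update ω i (!ω i)) (by simp [hij.symm, hω])
            linarith
          · linarith [h ω hω]
      _ = 2 * ∑ ω, g (x ω) := by rw [Finset.sum_add_distrib, hsum, two_mul]
  have hcard : (0 : ℝ) < Fintype.card (Fin N → Bool) := by exact_mod_cast Fintype.card_pos
  change c / 2 ≤ (Fintype.card (Fin N → Bool) : ℝ)⁻¹ * ∑ ω, g (x ω)
  rw [le_inv_mul_iff₀ hcard]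
  linarith

/-- The `L¹`-seminorm of a finite measure on a compact family of functionals of norm at most one
tends to zero along weakly null sequences, by dominated convergence. -/
theorem exists_seminorm_eq_integral {𝕜 W : Type*} [RCLike 𝕜] [NormedAddCommGroup W]
    [NormedSpace 𝕜 W] {K : Type*} [TopologicalSpace K] [CompactSpace K] [MeasurableSpace K]
    [BorelSpace K] (μ : Measure K) [IsFiniteMeasure μ] (e : K → StrongDual 𝕜 W)
    (he : ∀ w, Continuous fun k => e k w) (he₁ : ∀ k, ‖e k‖ ≤ 1) :
    ∃ p : Seminorm 𝕜 W, (∀ w, p w = ∫ k, ‖e k w‖ ∂μ) ∧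
      ∀ z : ℕ → W, TendstoWeakly 𝕜 z atTop 0 → Tendsto (fun n => p (z n)) atTop (𝓝 0) := by
  have hint : ∀ w, Integrable (fun k => ‖e k w‖) μ := fun w =>
    (he w).norm.integrable_of_hasCompactSupport (HasCompactSupport.of_compactSpace _)
  refine ⟨Seminorm.of (fun w => ∫ k, ‖e k w‖ ∂μ) (fun v w => ?_) (fun c w => ?_),
    fun w => rfl, fun z hz => ?_⟩
  · rw [← integral_add (hint v) (hint w)]
    refine integral_mono (hint _) ((hint v).add (hint w)) fun k => ?_
    simpa using norm_add_le (e k v) (e k w)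
  · simp only [map_smul, norm_smul]
    exact integral_const_mul _ _
  · obtain ⟨C, hC⟩ := hz.exists_norm_le
    have := tendsto_integral_of_dominated_convergence (μ := μ) (F := fun n k => ‖e k (z n)‖)
      (f := fun _ => 0) (fun _ => C) (fun n => (hint (z n)).aestronglyMeasurable)
      (integrable_const C)
      (fun n => Eventually.of_forall fun k => by
        rw [norm_norm]
        exact ((e k).le_of_opNorm_le (he₁ k) _).trans (by simpa using hC n))
      (Eventually.of_forall fun k => by simpa using (hz (e k)).norm)
    simp only [integral_zero] at this
    exact this

/-- An independent sequence of functionals is separated for an `L¹`-seminorm that vanishes in the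
limit along all weakly null sequences. The measure is a limit of the uniform distributions on
points of the unit ball that realize all sign patterns of the first `N` functionals. -/
theorem exists_seminorm_of_independent {𝕜 X : Type*} [RCLike 𝕜] [NormedAddCommGroup X]
    [NormedSpace 𝕜 X] (y : ℕ → StrongDual 𝕜 X) {r s : ℝ}
    (h : ∀ (ω : ℕ → Bool) (N : ℕ), ∃ x : X, ‖x‖ ≤ 1 ∧ ∀ i < N,
      if ω i then s < RCLike.re (y i x) else RCLike.re (y i x) < r) :
    ∃ p : Seminorm 𝕜 (StrongDual 𝕜 X),
      (∀ z : ℕ → StrongDual 𝕜 X, TendstoWeakly 𝕜 z atTop 0 →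
        Tendsto (fun n => p (z n)) atTop (𝓝 0)) ∧
      ∀ i j, i ≠ j → (s - r) / 2 ≤ p (y i - y j) := by
  choose x hx₁ hx using h
  let K := (WeakDual.toStrongDual ⁻¹' Metric.closedBall (0 : StrongDual 𝕜 (StrongDual 𝕜 X)) 1 :
    Set (WeakDual 𝕜 (StrongDual 𝕜 X)))
  have : CompactSpace K := isCompact_iff_compactSpace.1 (WeakDual.isCompact_closedBall _ _)
  let : MeasurableSpace K := borel K
  have : BorelSpace K := ⟨rfl⟩
  let ev : StrongDual 𝕜 X → C(K, ℝ) := fun w =>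
    ⟨fun k => ‖k.1 w‖, ((WeakDual.eval_continuous w).comp continuous_subtype_val).norm⟩
  let pt : X → WeakDual 𝕜 (StrongDual 𝕜 X) := fun a =>
    StrongDual.toWeakDual (NormedSpace.inclusionInDoubleDual 𝕜 X a)
  let ext : ∀ N, (Fin N → Bool) → ℕ → Bool := fun N ω i => if hi : i < N then ω ⟨i, hi⟩ else true
  let q : ∀ N, (Fin N → Bool) → K := fun N ω => ⟨pt (x (ext N ω) N), by
    refine (mem_closedBall_zero_iff (E := StrongDual 𝕜 (StrongDual 𝕜 X))).2 ?_
    exact (NormedSpace.double_dual_bound 𝕜 X _).trans (hx₁ _ _)⟩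
  obtain ⟨μ, hμ, hlim⟩ := exists_measure_tendsto_integral (hyperfilter ℕ)
    (fun N => pointAverage (q N)) (fun N => pointAverage_nonneg _) (fun N => abs_pointAverage_le _)
  obtain ⟨p, hp, hp₀⟩ := exists_seminorm_eq_integral (𝕜 := 𝕜) μ
    (fun k : K => WeakDual.toStrongDual k.1)
    (fun w => (WeakDual.eval_continuous w).comp continuous_subtype_val)
    (fun k => (mem_closedBall_zero_iff (E := StrongDual 𝕜 (StrongDual 𝕜 X))).1 k.2)
  refine ⟨p, hp₀, fun i j hij => ?_⟩
  rw [hp]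
  refine ge_of_tendsto (hlim (ev (y i - y j))) ?_
  have hN : ∀ᶠ N in (hyperfilter ℕ : Filter ℕ), max i j < N :=
    Nat.hyperfilter_le_atTop (eventually_gt_atTop _)
  filter_upwards [hN] with N hN
  have hi : i < N := (le_max_left _ _).trans_lt hN
  have hj : j < N := (le_max_right _ _).trans_lt hN
  refine half_le_pointAverage (i := ⟨i, hi⟩) (j := ⟨j, hj⟩) (q N) _
    (fun k => norm_nonneg _) (by simpa using hij) fun ω hω => ?_
  have hxi := hx (ext N ω) N i hi
  have hxj := hx (ext N ω) N j hj
  have hle := RCLike.abs_re_le_norm (y i (x (ext N ω) N) - y j (x (ext N ω) N))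
  rw [map_sub] at hle
  change s - r ≤ ‖(y i - y j) (x (ext N ω) N)‖
  rw [sub_apply]
  refine le_trans ?_ hle
  simp only [ext, hi, hj, dif_pos] at hxi hxj
  rw [le_abs]
  cases h₁ : ω ⟨i, hi⟩ <;> cases h₂ : ω ⟨j, hj⟩ <;>
    simp only [h₁, h₂, ne_eq, not_true_eq_false, if_true, Bool.false_eq_true, if_false] at hω hxi hxj
  · right; linarith
  · left; linarith

end LimitMeasure

/-! ### Seminorms continuous for the finest topologies -/

section FinestTopologies

open scoped ComplexOrder

variable {𝕜 : Type*} [RCLike 𝕜] {E : Type*} [AddCommGroup E] [Module 𝕜 E]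

/-- The topology defined by a single seminorm. -/
@[reducible] def seminormTopology (p : Seminorm 𝕜 E) : TopologicalSpace E :=
  p.toAddGroupSeminorm.toSeminormedAddCommGroup.toPseudoMetricSpace.toUniformSpace.toTopologicalSpace

theorem hasBasis_nhds_zero_seminormTopology (p : Seminorm 𝕜 E) :
    (@nhds E (seminormTopology p) 0).HasBasis (fun ε : ℝ => 0 < ε) fun ε => {x | p x < ε} := by
  let : SeminormedAddCommGroup E := p.toAddGroupSeminorm.toSeminormedAddCommGroup
  have h := Metric.nhds_basis_ball (x := (0 : E))
  have hball : ∀ ε, Metric.ball (0 : E) ε = {x | p x < ε} := fun ε => by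
    ext x
    rw [mem_ball_zero_iff]
    rfl
  exact h.to_hasBasis (fun ε hε => ⟨ε, hε, (hball ε).ge⟩) fun ε hε => ⟨ε, hε, (hball ε).le⟩

theorem isLocallyConvexTopology_seminormTopology (p : Seminorm 𝕜 E) :
    IsLocallyConvexTopology 𝕜 (seminormTopology p) := by
  have hb := hasBasis_nhds_zero_seminormTopology p
  let : SeminormedAddCommGroup E := p.toAddGroupSeminorm.toSeminormedAddCommGroup
  let : NormedSpace 𝕜 E := ⟨fun c x => (map_smul_eq_mul p c x).le⟩
  refine ⟨inferInstance, inferInstance, LocallyConvexSpace.ofBasisZero 𝕜 E _ _ hb fun ε _ => ?_⟩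
  intro x hx y hy α β hα hβ hαβ
  have hnorm := norm_add_norm_eq_one_of_nonneg hα hβ hαβ
  have h₁ : p (α • x + β • y) ≤ ‖α‖ * p x + ‖β‖ * p y := by
    simpa only [map_smul_eq_mul] using map_add_le_add p (α • x) (β • y)
  have hx' : p x < ε := hx
  have hy' : p y < ε := hy
  change p (α • x + β • y) < ε
  have h₂ : ‖α‖ * p x + ‖β‖ * p y ≤ max (p x) (p y) := by
    calc ‖α‖ * p x + ‖β‖ * p y ≤ ‖α‖ * max (p x) (p y) + ‖β‖ * max (p x) (p y) := by
          gcongr <;> simp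
      _ = max (p x) (p y) := by rw [← add_mul, hnorm, one_mul]
  exact (h₁.trans h₂).trans_lt (max_lt hx' hy')

theorem IsLocallyConvexTopology.inf {s t : TopologicalSpace E} (hs : IsLocallyConvexTopology 𝕜 s)
    (ht : IsLocallyConvexTopology 𝕜 t) : IsLocallyConvexTopology 𝕜 (s ⊓ t) := by
  rw [← sInf_pair]
  exact isLocallyConvexTopology_sInf (by simp [hs, ht])

/-- A seminorm that tends to zero along all `t`-null sequences is continuous for `t⁺`. -/
theorem mem_nhds_plusTopology {t : TopologicalSpace E} (ht : IsLocallyConvexTopology 𝕜 t)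
    (p : Seminorm 𝕜 E)
    (hp : ∀ x : ℕ → E, Tendsto x atTop (@nhds E t 0) → Tendsto (fun n => p (x n)) atTop (𝓝 0))
    {ε : ℝ} (hε : 0 < ε) : {x | p x < ε} ∈ @nhds E (plusTopology 𝕜 t) 0 := by
  have hlc := isLocallyConvexTopology_seminormTopology p
  have hle : plusTopology 𝕜 t ≤ t ⊓ seminormTopology p := by
    refine sInf_le ⟨ht.inf hlc, fun x a => ?_⟩
    rw [nhds_inf, tendsto_inf, and_iff_left_iff_imp]
    intro hx
    rw [tendsto_nhds_iff_sub hlc.1, (hasBasis_nhds_zero_seminormTopology p).tendsto_right_iff]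
    exact fun ε hε => (hp _ ((tendsto_nhds_iff_sub ht.1).1 hx)).eventually_lt_const hε
  exact _root_.nhds_mono (hle.trans inf_le_right)
    ((hasBasis_nhds_zero_seminormTopology p).mem_of_mem hε)

/-- A seminorm for which all `t`-precompact sets are precompact is continuous for `tᵖ`. -/
theorem mem_nhds_precompactTopology {t : TopologicalSpace E} (ht : IsLocallyConvexTopology 𝕜 t)
    (p : Seminorm 𝕜 E)
    (hp : ∀ A, IsPrecompactFor t A → IsPrecompactFor (seminormTopology p) A)
    {ε : ℝ} (hε : 0 < ε) : {x | p x < ε} ∈ @nhds E (precompactTopology 𝕜 t) 0 := by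
  have hlc := isLocallyConvexTopology_seminormTopology p
  have hle : precompactTopology 𝕜 t ≤ t ⊓ seminormTopology p := by
    refine sInf_le ⟨ht.inf hlc, fun A => ⟨fun h U hU => h U (_root_.nhds_mono inf_le_left hU), ?_⟩⟩
    intro hA
    rw [isPrecompactFor_iff_ultrafilter _ (ht.inf hlc).1]
    intro f hf
    rw [nhds_inf, tendsto_inf]
    exact ⟨(isPrecompactFor_iff_ultrafilter _ ht.1 A).1 hA f hf,
      (isPrecompactFor_iff_ultrafilter _ hlc.1 A).1 (hp A hA) f hf⟩
  exact _root_.nhds_mono (hle.trans inf_le_right)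
    ((hasBasis_nhds_zero_seminormTopology p).mem_of_mem hε)

theorem isPrecompactFor_range_of_tendsto {t : TopologicalSpace E}
    (ht : @IsTopologicalAddGroup E t _) {x : ℕ → E} {a : E}
    (hx : Tendsto x atTop (@nhds E t a)) : IsPrecompactFor t (range x) := by
  intro U hU
  obtain ⟨N, hN⟩ := eventually_atTop.1 ((tendsto_nhds_iff_sub ht).1 hx hU)
  refine ⟨insert a (x '' Iio N), ((finite_Iio N).image x).insert a, ?_⟩
  rintro _ ⟨n, rfl⟩
  rcases lt_or_ge n N with hn | hn
  · exact ⟨x n, mem_insert_of_mem _ ⟨n, hn, rfl⟩, 0, @mem_of_mem_nhds E t _ _ hU, add_zero _⟩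
  · exact ⟨a, mem_insert _ _, x n - a, hN n hn, add_sub_cancel _ _⟩

/-- A set that is not precompact contains a sequence that is uniformly separated. -/
theorem exists_seq_of_not_isPrecompactFor {t : TopologicalSpace E} {A : Set E}
    (hA : ¬ IsPrecompactFor t A) :
    ∃ U ∈ @nhds E t 0, ∃ y : ℕ → E, (∀ n, y n ∈ A) ∧ ∀ m n, m < n → y n - y m ∉ U := by
  simp only [IsPrecompactFor, not_forall, not_exists, not_and] at hA
  obtain ⟨U, hU, h⟩ := hA
  obtain ⟨y, hy⟩ := exists_seq_of_forall_finset_exists (· ∈ A) (fun a b => b - a ∉ U) fun s _ => by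
    obtain ⟨b, hb, hbs⟩ := not_subset.1 (h s s.finite_toSet)
    exact ⟨b, hb, fun a ha hU => hbs ⟨a, ha, b - a, hU, add_sub_cancel _ _⟩⟩
  exact ⟨U, hU, y, hy⟩

/-- A precompact sequence is bounded, in the form that its multiples by `2⁻ⁿ` tend to zero. -/
theorem tendsto_inv_two_pow_smul [t : TopologicalSpace E] [IsTopologicalAddGroup E]
    [ContinuousSMul 𝕜 E] {w : ℕ → E} (hw : IsPrecompactFor t (range w)) :
    Tendsto (fun n => ((2 : 𝕜) ^ n)⁻¹ • w n) (hyperfilter ℕ) (𝓝 0) := by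
  have hc : Tendsto (fun n : ℕ => ((2 : 𝕜) ^ n)⁻¹) (hyperfilter ℕ) (𝓝 0) := by
    have : Tendsto (fun n : ℕ => ((2 : 𝕜)⁻¹) ^ n) atTop (𝓝 0) :=
      tendsto_pow_atTop_nhds_zero_of_norm_lt_one (by norm_num)
    simpa only [inv_pow] using this.mono_left Nat.hyperfilter_le_atTop
  have hd := (isPrecompactFor_iff_ultrafilter t inferInstance _).1 hw ((hyperfilter ℕ).map w)
    (mem_map.2 (Eventually.of_forall fun n => mem_range_self n))
  have hd' : Tendsto (fun p : ℕ × ℕ => w p.2 - w p.1)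
      ((hyperfilter ℕ : Filter ℕ) ×ˢ (hyperfilter ℕ : Filter ℕ)) (𝓝 0) :=
    hd.comp (tendsto_map.prodMap tendsto_map)
  have hs := (hc.comp tendsto_snd).smul hd'
  rw [zero_smul] at hs
  intro V hV
  obtain ⟨V', hV', hadd⟩ := exists_nhds_zero_half hV
  obtain ⟨m, hm⟩ := (Eventually.curry (hs.eventually hV')).exists
  have hm' : Tendsto (fun n => ((2 : 𝕜) ^ n)⁻¹ • w m) (hyperfilter ℕ) (𝓝 0) := by
    simpa using hc.smul_const (w m)
  refine mem_map.2 ?_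
  filter_upwards [hm, hm'.eventually hV'] with n h₁ h₂
  have := hadd _ h₁ _ h₂
  simpa [← smul_add] using this

theorem exists_convex_nhds_zero_half [TopologicalSpace E] [IsTopologicalAddGroup E]
    [LocallyConvexSpace 𝕜 E] {V : Set E} (hV : V ∈ 𝓝 (0 : E)) :
    ∃ W ∈ 𝓝 (0 : E), Convex 𝕜 W ∧ ∀ a ∈ W, ∀ b ∈ W, a + b ∈ V := by
  obtain ⟨V', hV', hadd⟩ := exists_nhds_zero_half hV
  obtain ⟨W, ⟨hW, hconv⟩, hsub⟩ :=
    (LocallyConvexSpace.convex_basis (𝕜 := 𝕜) (0 : E)).mem_iff.1 hV'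
  exact ⟨W, hW, hconv, fun a ha b hb => hadd a (hsub ha) b (hsub hb)⟩

end FinestTopologies

/-! ### Precompact sets under the reciprocal Dunford–Pettis property -/

section PrecompactSetsAreWeaklyCompact

open scoped ComplexOrder BoundedContinuousFunction

variable {𝕜 : Type v} [RCLike 𝕜] {X : Type u} [NormedAddCommGroup X] [NormedSpace 𝕜 X]

/-- The operator `X → C_b(A)` of evaluation on a bounded set `A` of functionals. -/
theorem exists_evaluationOperator {A : Set (StrongDual 𝕜 X)} {C : ℝ} (hC : ∀ y ∈ A, ‖y‖ ≤ C) :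
    ∃ T : X →L[𝕜] (A →ᵇ 𝕜), ∀ x y, T x y = y.1 x := by
  have hC' : ∀ (y : A) (x : X), ‖y.1 x‖ ≤ C * ‖x‖ := fun y x => y.1.le_of_opNorm_le (hC _ y.2) x
  let T : X →ₗ[𝕜] (A →ᵇ 𝕜) :=
    { toFun := fun x => BoundedContinuousFunction.ofNormedAddCommGroup (fun y : A => y.1 x)
        (by fun_prop) (C * ‖x‖) fun y => hC' y x
      map_add' := fun x x' => by ext y; simp
      map_smul' := fun c x => by ext y; simp }
  refine ⟨T.mkContinuous |C| fun x => ?_, fun x y => rfl⟩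
  refine (BoundedContinuousFunction.norm_le (by positivity)).2 fun y => ?_
  exact (hC' y x).trans (mul_le_mul_of_nonneg_right (le_abs_self C) (norm_nonneg _))

theorem isDunfordPettisOperator_of_tendsto {Y : Type*} [NormedAddCommGroup Y] [NormedSpace 𝕜 Y]
    {T : X →L[𝕜] Y}
    (hT : ∀ z : ℕ → X, TendstoWeakly 𝕜 z atTop 0 → Tendsto (fun n => T (z n)) atTop (𝓝 0)) :
    IsDunfordPettisOperator T := by
  intro K hK
  refine IsSeqCompact.isCompact fun y hy => ?_
  choose x hxK hx using hy
  obtain ⟨θ, a, ha, hθ, hxa⟩ := hK.exists_subseq hxK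
  refine ⟨T a, ⟨a, ha, rfl⟩, θ, hθ, ?_⟩
  have h := hT (fun n => x (θ n) - a) fun φ => by
    simpa using (hxa φ).sub_const (φ a)
  simp_rw [map_sub, hx] at h
  exact tendsto_sub_nhds_zero_iff.1 h

/-- The precompact topology of the Mackey topology is coarser than the norm topology. -/
theorem mem_nhds_of_mem_nhds_precompactTopology {V : Set (StrongDual 𝕜 X)}
    (hV : V ∈ @nhds _ (precompactTopology 𝕜 (mackeyTopology 𝕜 X)) 0) :
    V ∈ 𝓝 (0 : StrongDual 𝕜 X) := by
  have hτ := isLocallyConvexTopology_mackeyTopology 𝕜 X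
  obtain ⟨hlc, hpre⟩ := (isLeast_precompactTopology hτ).1
  by_contra hcon
  have hex : ∀ n : ℕ, ∃ z : StrongDual 𝕜 X, ‖z‖ < (1 / 4 : ℝ) ^ n ∧ z ∉ V := fun n => by
    by_contra! h
    exact hcon (Metric.mem_nhds_iff.2 ⟨(1 / 4 : ℝ) ^ n, by positivity, fun z hz =>
      h z (mem_ball_zero_iff.1 hz)⟩)
  choose z hz hzV using hex
  -- the multiples `2ⁿ zₙ` still tend to zero in norm, hence form a precompact set
  have hw : Tendsto (fun n => ‖(2 : 𝕜) ^ n • z n‖) atTop (𝓝 0) := by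
    refine squeeze_zero (fun _ => norm_nonneg _) (fun n => ?_)
      (tendsto_pow_atTop_nhds_zero_of_lt_one (r := (1 / 2 : ℝ)) (by norm_num) (by norm_num))
    refine (ContinuousLinearMap.opNorm_smul_le _ _).trans ?_
    rw [norm_pow, RCLike.norm_ofNat]
    calc (2 : ℝ) ^ n * ‖z n‖ ≤ 2 ^ n * (1 / 4) ^ n := by gcongr; exact (hz n).le
      _ = (1 / 2) ^ n := by rw [← mul_pow]; norm_num
  have hp := (hpre _).2 (isPrecompactFor_range_of_tendsto hτ.1
    (tendsto_mackeyTopology_zero_of_norm hw))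
  have h := @tendsto_inv_two_pow_smul 𝕜 _ _ _ _ (precompactTopology 𝕜 (mackeyTopology 𝕜 X))
    hlc.1 hlc.2 _ hp
  obtain ⟨n, hn⟩ := (h.eventually hV).exists
  rw [inv_smul_smul₀ (pow_ne_zero n two_ne_zero)] at hn
  exact hzV n hn

variable [CompleteSpace X]

/-- In the presence of the reciprocal Dunford–Pettis property, the sets that are precompact for
the Mackey topology are relatively weakly compact. -/
theorem HasReciprocalDunfordPettisProperty.exists_tendstoWeakly
    (hX : HasReciprocalDunfordPettisProperty 𝕜 X) {A : Set (StrongDual 𝕜 X)}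
    (hA : IsPrecompactFor (mackeyTopology 𝕜 X) A) {ι : Type*} (U : Ultrafilter ι)
    {y : ι → StrongDual 𝕜 X} (hy : ∀ i, y i ∈ A) : ∃ a, TendstoWeakly 𝕜 y U a := by
  obtain ⟨C, hC⟩ := hA.exists_norm_le
  obtain ⟨T, hT⟩ := exists_evaluationOperator hC
  have hDP : IsDunfordPettisOperator T := by
    refine isDunfordPettisOperator_of_tendsto fun z hz => ?_
    rw [Metric.tendsto_nhds]
    intro ε hε
    filter_upwards [hA.eventually_norm_lt hz (half_pos hε)] with n hn
    rw [dist_zero_right]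
    refine lt_of_le_of_lt ?_ (half_lt_self hε)
    exact (BoundedContinuousFunction.norm_le (half_pos hε).le).2 fun b => by
      rw [hT]
      exact (hn b b.2).le
  have hW := hX _ T hDP
  -- the point evaluations on `A` converge in the weak-star compact unit ball of the dual
  let ev : ι → StrongDual 𝕜 (A →ᵇ 𝕜) := fun i =>
    LinearMap.mkContinuous
      { toFun := fun g => g ⟨y i, hy i⟩, map_add' := fun _ _ => rfl, map_smul' := fun _ _ => rfl } 1
      fun g => by simpa using g.norm_coe_le_norm ⟨y i, hy i⟩
  obtain ⟨g, -, hg⟩ := exists_weakStar_limit U ev (C := 1)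
    (Eventually.of_forall fun i => LinearMap.mkContinuous_norm_le _ zero_le_one _)
  refine ⟨g.comp T, fun f => ?_⟩
  obtain ⟨w, hw⟩ := hW.exists_eq_comp f
  rw [hw g]
  refine (hg w).congr fun i => ?_
  rw [← hw (ev i)]
  congr 1
  ext x
  exact hT x ⟨y i, hy i⟩

/-- Under the reciprocal Dunford–Pettis property, weak limits within a precompact set of the
Mackey topology are limits for `τᵖ`: the ultrafilter is `τᵖ`-Cauchy, and `τᵖ` has a base of
neighbourhoods of zero that are weakly closed. -/
theorem HasReciprocalDunfordPettisProperty.exists_tendsto_precompactTopology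
    (hX : HasReciprocalDunfordPettisProperty 𝕜 X) {A : Set (StrongDual 𝕜 X)}
    (hA : IsPrecompactFor (mackeyTopology 𝕜 X) A) {ι : Type*} (U : Ultrafilter ι)
    {y : ι → StrongDual 𝕜 X} (hy : ∀ i, y i ∈ A) :
    ∃ a, TendstoWeakly 𝕜 y U a ∧
      Tendsto y U (@nhds _ (precompactTopology 𝕜 (mackeyTopology 𝕜 X)) a) := by
  obtain ⟨hlc, hpre⟩ :=
    (isLeast_precompactTopology (isLocallyConvexTopology_mackeyTopology 𝕜 X)).1
  obtain ⟨a, ha⟩ := hX.exists_tendstoWeakly hA U hy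
  refine ⟨a, ha, (tendsto_nhds_iff_sub hlc.1).2 fun V hV => ?_⟩
  obtain ⟨W, hW, hconv, hadd⟩ := @exists_convex_nhds_zero_half 𝕜 _ _ _ _
    (precompactTopology 𝕜 (mackeyTopology 𝕜 X)) hlc.1 hlc.3 V hV
  have hWn := mem_nhds_of_mem_nhds_precompactTopology hW
  have hd : Tendsto (fun p : ι × ι => y p.1 - y p.2) ((U : Filter ι) ×ˢ (U : Filter ι))
      (@nhds _ (precompactTopology 𝕜 (mackeyTopology 𝕜 X)) 0) :=
    ((isPrecompactFor_iff_ultrafilter _ hlc.1 A).1 ((hpre A).2 hA) (U.map y)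
      (mem_map.2 (Eventually.of_forall hy))).comp
      ((tendsto_map.comp tendsto_snd).prodMk (tendsto_map.comp tendsto_fst))
  refine mem_map.2 ((Eventually.curry (hd.eventually hW)).mono fun i hi => ?_)
  have hw : TendstoWeakly 𝕜 (fun j => y i - y j) U (y i - a) := fun φ => by
    simpa using (ha φ).const_sub (φ (y i))
  have hcl := hw.mem_closure (convex_RCLike_iff_convex_real.1 hconv) hi
  -- `W` is a norm neighbourhood of zero, so its norm closure is contained in `W + W`
  have hsub : ∀ᶠ w in 𝓝 (y i - a), y i - a - w ∈ W := by
    have : Tendsto (fun w => y i - a - w) (𝓝 (y i - a)) (𝓝 0) := by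
      have h := (continuous_const.sub continuous_id).tendsto (f := fun w => y i - a - w) (y i - a)
      rwa [sub_self] at h
    exact this.eventually hWn
  obtain ⟨w, hw₁, hw₂⟩ := (mem_closure_iff_frequently.1 hcl).and_eventually hsub |>.exists
  simpa using hadd w hw₁ _ hw₂

/-- The reciprocal Dunford–Pettis property implies `τ⁺ = τᵖ`. -/
theorem HasReciprocalDunfordPettisProperty.plusTopology_eq
    (hX : HasReciprocalDunfordPettisProperty 𝕜 X) :
    plusTopology 𝕜 (mackeyTopology 𝕜 X) = precompactTopology 𝕜 (mackeyTopology 𝕜 X) := by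
  have hτ := isLocallyConvexTopology_mackeyTopology 𝕜 X
  obtain ⟨⟨hlc₁, hseq⟩, hmin₁⟩ := isLeast_plusTopology hτ
  obtain ⟨⟨hlc₂, hpre⟩, hmin₂⟩ := isLeast_precompactTopology hτ
  have hle₁ : plusTopology 𝕜 (mackeyTopology 𝕜 X) ≤ mackeyTopology 𝕜 X :=
    hmin₁ ⟨hτ, fun _ _ => Iff.rfl⟩
  have hle₂ : precompactTopology 𝕜 (mackeyTopology 𝕜 X) ≤ mackeyTopology 𝕜 X :=
    hmin₂ ⟨hτ, fun _ => Iff.rfl⟩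
  refine le_antisymm (hmin₁ ⟨hlc₂, fun x a => ⟨fun h => h.mono_right (_root_.nhds_mono hle₂),
    fun h => ?_⟩⟩) (hmin₂ ⟨hlc₁, fun A => ⟨fun h V hV => h V (_root_.nhds_mono hle₁ hV),
    fun hA => ?_⟩⟩)
  · refine (tendsto_iff_ultrafilter _ _ _).2 fun U hU => ?_
    obtain ⟨b, -, hb⟩ := hX.exists_tendsto_precompactTopology
      (isPrecompactFor_range_of_tendsto hτ.1 h) U (y := x) fun n => mem_range_self n
    have hba : b = a := ContinuousLinearMap.ext fun v => tendsto_nhds_unique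
      (tendsto_apply_of_tendsto_mackeyTopology (hb.mono_right (_root_.nhds_mono hle₂)) v)
      ((tendsto_apply_of_tendsto_mackeyTopology h v).mono_left hU)
    exact hba ▸ hb
  · by_contra hcon
    obtain ⟨V, hV, y, hyA, hy⟩ := exists_seq_of_not_isPrecompactFor hcon
    obtain ⟨C, hC⟩ := hA.exists_norm_le
    obtain ⟨θ, a, hθ, ha⟩ := exists_subseq_tendstoWeakly (𝕜 := 𝕜) y (fun n => hC _ (hyA n))
      fun U => hX.exists_tendstoWeakly hA U hyA
    have hlim : Tendsto (y ∘ θ) atTop (@nhds _ (precompactTopology 𝕜 (mackeyTopology 𝕜 X)) a) := by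
      refine (tendsto_iff_ultrafilter _ _ _).2 fun U hU => ?_
      obtain ⟨b, hbw, hb⟩ := hX.exists_tendsto_precompactTopology hA U (y := y ∘ θ)
        fun n => hyA _
      rwa [hbw.unique (ha.mono hU)] at hb
    have hlim' := (hseq _ _).2 (hlim.mono_right (_root_.nhds_mono hle₂))
    have hd := (isPrecompactFor_iff_ultrafilter _ hlc₁.1 _).1
      (isPrecompactFor_range_of_tendsto hlc₁.1 hlim') ((hyperfilter ℕ).map (y ∘ θ))
      (mem_map.2 (Eventually.of_forall fun n => mem_range_self n))
    have hd' : Tendsto (fun p : ℕ × ℕ => y (θ p.2) - y (θ p.1))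
        ((hyperfilter ℕ : Filter ℕ) ×ˢ (hyperfilter ℕ : Filter ℕ))
        (@nhds _ (plusTopology 𝕜 (mackeyTopology 𝕜 X)) 0) :=
      hd.comp (tendsto_map.prodMap tendsto_map)
    obtain ⟨m, hm⟩ := (Eventually.curry (hd'.eventually hV)).exists
    obtain ⟨n, hn, hmn⟩ := (hm.and (Nat.hyperfilter_le_atTop (eventually_gt_atTop m))).exists
    exact hy _ _ (hθ hmn) hn

end PrecompactSetsAreWeaklyCompact

/-! ### Adjoints of Dunford–Pettis operators -/

section AdjointOfDunfordPettisOperator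

variable {𝕜 : Type*} [RCLike 𝕜] {X Y : Type*} [NormedAddCommGroup X] [NormedSpace 𝕜 X]
  [NormedAddCommGroup Y] [NormedSpace 𝕜 Y]

/-- The adjoint of a Dunford–Pettis operator is continuous on the unit ball, from the weak-star
topology to the Mackey topology. -/
theorem IsDunfordPettisOperator.tendsto_comp {T : X →L[𝕜] Y} (hT : IsDunfordPettisOperator T)
    {ι : Type*} {l : Filter ι} {g : ι → StrongDual 𝕜 Y} {g₀ : StrongDual 𝕜 Y}
    (hg : ∀ i, ‖g i‖ ≤ 1) (hg₀ : ‖g₀‖ ≤ 1) (h : ∀ w, Tendsto (fun i => g i w) l (𝓝 (g₀ w))) :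
    Tendsto (fun i => (g i).comp T) l (@nhds _ (mackeyTopology 𝕜 X) (g₀.comp T)) := by
  rw [tendsto_nhds_iff_sub (isLocallyConvexTopology_mackeyTopology 𝕜 X).1,
    tendsto_mackeyTopology_zero_iff]
  intro K hK ε hε
  have hε' : 0 < ε / 4 := by positivity
  obtain ⟨t, ht, hsub⟩ := Metric.totallyBounded_iff.1 (hT K hK.1).totallyBounded _ hε'
  have hev : ∀ᶠ i in l, ∀ w ∈ t, ‖(g i - g₀) w‖ < ε / 4 :=
    (eventually_all_finite ht).2 fun w _ => by
      have := (tendsto_sub_nhds_zero_iff.2 (h w)).norm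
      rw [norm_zero] at this
      exact this.eventually_lt_const hε'
  filter_upwards [hev] with i hi x hx
  obtain ⟨w, hw, hxw⟩ := mem_iUnion₂.1 (hsub ⟨x, hx, rfl⟩)
  rw [Metric.mem_ball, dist_eq_norm] at hxw
  have hn : ‖g i - g₀‖ ≤ 2 := (norm_sub_le _ _).trans (by linarith [hg i])
  calc ‖((g i).comp T - g₀.comp T) x‖ = ‖(g i - g₀) (T x - w) + (g i - g₀) w‖ := by
        rw [← map_add, sub_add_cancel]
        rfl
    _ ≤ ‖(g i - g₀) (T x - w)‖ + ‖(g i - g₀) w‖ := norm_add_le _ _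
    _ ≤ 2 * (ε / 4) + ‖(g i - g₀) w‖ :=
        add_le_add ((g i - g₀).le_of_opNorm_le_of_le hn hxw.le) le_rfl
    _ < ε := by linarith [hi w hw]

theorem isPrecompactFor_of_forall_ultrafilter {E : Type*} [AddCommGroup E] [t : TopologicalSpace E]
    [IsTopologicalAddGroup E] {A : Set E} (h : ∀ U : Ultrafilter E, A ∈ U → ∃ a, (U : Filter E) ≤ 𝓝 a) :
    IsPrecompactFor t A := by
  refine (isPrecompactFor_iff_ultrafilter t inferInstance A).2 fun U hU => ?_
  obtain ⟨a, ha⟩ := h U hU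
  have h₁ : Tendsto (fun x : E => x) U (𝓝 a) := ha
  simpa using (h₁.comp tendsto_snd).sub (h₁.comp tendsto_fst)

/-- The adjoint of a Dunford–Pettis operator maps the unit ball to a set that is precompact for
the Mackey topology. -/
theorem IsDunfordPettisOperator.isPrecompactFor {T : X →L[𝕜] Y} (hT : IsDunfordPettisOperator T) :
    IsPrecompactFor (mackeyTopology 𝕜 X)
      ((fun g : StrongDual 𝕜 Y => g.comp T) '' {g | ‖g‖ ≤ 1}) := by
  refine @isPrecompactFor_of_forall_ultrafilter _ _ (mackeyTopology 𝕜 X)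
    (isLocallyConvexTopology_mackeyTopology 𝕜 X).1 _ fun U hU => ?_
  have hex : ∀ y : StrongDual 𝕜 X, ∃ g : StrongDual 𝕜 Y, ‖g‖ ≤ 1 ∧
      (y ∈ (fun g : StrongDual 𝕜 Y => g.comp T) '' {g | ‖g‖ ≤ 1} → g.comp T = y) := fun y => by
    by_cases hy : y ∈ (fun g : StrongDual 𝕜 Y => g.comp T) '' {g | ‖g‖ ≤ 1}
    · obtain ⟨g, hg, rfl⟩ := hy
      exact ⟨g, hg, fun _ => rfl⟩
    · exact ⟨0, by simp, fun h => absurd h hy⟩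
  choose σ hσ₁ hσ₂ using hex
  obtain ⟨g₀, hg₀, hlim⟩ := exists_weakStar_limit U σ (Eventually.of_forall hσ₁)
  exact ⟨g₀.comp T, (hT.tendsto_comp hσ₁ hg₀ hlim).congr' (mem_of_superset hU hσ₂)⟩

end AdjointOfDunfordPettisOperator

/-! ### Consequences of the equality of the two topologies -/

section EqualityOfTopologies

variable {𝕜 : Type*} [RCLike 𝕜] {X Y : Type*} [NormedAddCommGroup X] [NormedSpace 𝕜 X]
  [CompleteSpace X] [NormedAddCommGroup Y] [NormedSpace 𝕜 Y]

/-- A set that is precompact for the Mackey topology is norm bounded, so its images under the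
elements of the double dual are precompact. -/
theorem IsPrecompactFor.seminormTopology_comp {A : Set (StrongDual 𝕜 X)}
    (hA : IsPrecompactFor (mackeyTopology 𝕜 X) A) (f : StrongDual 𝕜 (StrongDual 𝕜 X)) :
    IsPrecompactFor (seminormTopology ((normSeminorm 𝕜 𝕜).comp (f : StrongDual 𝕜 X →ₗ[𝕜] 𝕜))) A := by
  by_contra hcon
  obtain ⟨V, hV, y, hyA, hy⟩ := exists_seq_of_not_isPrecompactFor hcon
  obtain ⟨ε, hε, hεV⟩ := (hasBasis_nhds_zero_seminormTopology _).mem_iff.1 hV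
  obtain ⟨C, hC⟩ := hA.exists_norm_le
  obtain ⟨c, -, θ, hθ, hc⟩ := (isCompact_closedBall (0 : 𝕜) (‖f‖ * C)).tendsto_subseq
    (x := fun n => f (y n)) fun n => by simpa using f.le_opNorm_of_le (hC _ (hyA n))
  obtain ⟨N, hN⟩ := Metric.cauchySeq_iff'.1 hc.cauchySeq ε hε
  refine hy _ _ (hθ (Nat.lt_succ_self N)) (hεV ?_)
  have := hN (N + 1) (Nat.le_succ N)
  rw [dist_eq_norm] at this
  simpa using this

/-- If `τ⁺ = τᵖ`, then `τ`-convergent sequences are weakly convergent: each element of the double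
dual is continuous for `τᵖ`, hence for `τ⁺`. -/
theorem tendstoWeakly_of_plusTopology_eq
    (h : plusTopology 𝕜 (mackeyTopology 𝕜 X) = precompactTopology 𝕜 (mackeyTopology 𝕜 X))
    {y : ℕ → StrongDual 𝕜 X} {a : StrongDual 𝕜 X}
    (hy : Tendsto y atTop (@nhds _ (mackeyTopology 𝕜 X) a)) : TendstoWeakly 𝕜 y atTop a := by
  have hτ := isLocallyConvexTopology_mackeyTopology 𝕜 X
  obtain ⟨⟨hlc, hseq⟩, -⟩ := isLeast_plusTopology hτ
  intro f
  have hy' := (tendsto_nhds_iff_sub hlc.1).1 ((hseq y a).2 hy)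
  rw [← tendsto_sub_nhds_zero_iff, Metric.tendsto_nhds]
  intro ε hε
  have hmem := mem_nhds_precompactTopology hτ
    ((normSeminorm 𝕜 𝕜).comp (f : StrongDual 𝕜 X →ₗ[𝕜] 𝕜))
    (fun A hA => hA.seminormTopology_comp f) hε
  rw [← h] at hmem
  filter_upwards [hy'.eventually hmem] with n hn
  rw [dist_zero_right, ← map_sub]
  exact hn

/-- If `τ⁺ = τᵖ`, then a sequence in the image of the unit ball under the adjoint of a
Dunford–Pettis operator has a weakly convergent subsequence. By Rosenthal's dichotomy there would
otherwise be an independent subsequence, which is not precompact for some `τ⁺`-continuous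
`L¹`-seminorm. -/
theorem IsDunfordPettisOperator.exists_subseq_tendstoWeakly {T : X →L[𝕜] Y}
    (hT : IsDunfordPettisOperator T)
    (h : plusTopology 𝕜 (mackeyTopology 𝕜 X) = precompactTopology 𝕜 (mackeyTopology 𝕜 X))
    {g : ℕ → StrongDual 𝕜 Y} (hg : ∀ n, ‖g n‖ ≤ 1) :
    ∃ (θ : ℕ → ℕ) (a : StrongDual 𝕜 X), StrictMono θ ∧
      TendstoWeakly 𝕜 (fun n => (g (θ n)).comp T) atTop a := by
  have hτ := isLocallyConvexTopology_mackeyTopology 𝕜 X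
  rcases exists_subseq_tendsto_or_independent
    (fun n (x : {x : X // ‖x‖ ≤ 1}) => RCLike.re (g n (T x))) (fun x => ⟨‖T x‖, fun n =>
      (RCLike.abs_re_le_norm _).trans (((g n).le_of_opNorm_le (hg n) _).trans_eq (one_mul _))⟩) with
    ⟨θ, hθ, hconv⟩ | ⟨r, s, hrs, θ, hθ, hind⟩
  · choose L hL using hconv
    have hlim : ∀ U : Ultrafilter ℕ, (U : Filter ℕ) ≤ atTop → ∃ a : StrongDual 𝕜 X,
        Tendsto (fun n => (g (θ n)).comp T) U (@nhds _ (mackeyTopology 𝕜 X) a) ∧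
        ∀ x : {x : X // ‖x‖ ≤ 1}, RCLike.re (a x) = L x := fun U hU => by
      obtain ⟨g₀, hg₀, h₀⟩ := exists_weakStar_limit U (fun n => g (θ n))
        (Eventually.of_forall fun n => hg (θ n))
      refine ⟨g₀.comp T, hT.tendsto_comp (fun n => hg (θ n)) hg₀ h₀, fun x => ?_⟩
      exact tendsto_nhds_unique ((RCLike.continuous_re.tendsto _).comp (h₀ (T x)))
        ((hL x).mono_left hU)
    obtain ⟨a, -, ha⟩ := hlim (hyperfilter ℕ) Nat.hyperfilter_le_atTop
    refine ⟨θ, a, hθ, tendstoWeakly_of_plusTopology_eq h ?_⟩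
    refine (tendsto_iff_ultrafilter _ _ _).2 fun U hU => ?_
    obtain ⟨b, hb, hb'⟩ := hlim U hU
    -- a functional is determined by its real part on the unit ball
    have hba : b = a := by
      refine sub_eq_zero.1 (norm_le_zero_iff.1 ?_)
      refine ContinuousLinearMap.opNorm_le_of_unit_norm le_rfl fun x hx => ?_
      obtain ⟨c, hc, hcx⟩ := RCLike.exists_norm_eq_mul_self ((b - a) x)
      have hcx' : ‖c • x‖ ≤ 1 := by rw [norm_smul, hc, hx, one_mul]
      have h₀ : RCLike.re ((b - a) (c • x)) = 0 := by
        rw [sub_apply, map_sub, hb' ⟨_, hcx'⟩, ha ⟨_, hcx'⟩, sub_self]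
      rw [map_smul, smul_eq_mul, ← hcx, RCLike.ofReal_re] at h₀
      exact h₀.le
    exact hba ▸ hb
  · exfalso
    obtain ⟨p, hp, hsep⟩ := exists_seminorm_of_independent (fun n => (g (θ n)).comp T)
      (r := r) (s := s) fun ω N => by
        obtain ⟨x, hx⟩ := hind ω N
        exact ⟨x, x.2, hx⟩
    have hmem := mem_nhds_plusTopology hτ p
      (fun z hz => hp z (tendstoWeakly_of_plusTopology_eq h hz))
      (show 0 < (s - r) / 4 by linarith)
    rw [h] at hmem
    obtain ⟨F, hF, hsub⟩ :=
      ((isLeast_precompactTopology hτ).1.2 _).2 hT.isPrecompactFor _ hmem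
    have hex : ∀ n, ∃ b : F, p ((g (θ n)).comp T - b) < (s - r) / 4 := fun n => by
      obtain ⟨b, hb, u, hu, hbu⟩ := hsub ⟨g (θ n), hg _, rfl⟩
      refine ⟨⟨b, hb⟩, ?_⟩
      have hbu' : b + u = (g (θ n)).comp T := hbu
      rw [← hbu', add_sub_cancel_left]
      exact hu
    choose b hb using hex
    have : Finite F := hF
    obtain ⟨m, n, hmn, hbmn⟩ := Finite.exists_ne_map_eq_of_infinite b
    have h₁ := map_sub_le_add p ((g (θ m)).comp T - b m) ((g (θ n)).comp T - b m)
    rw [sub_sub_sub_cancel_right] at h₁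
    have h₂ := hb n
    rw [← hbmn] at h₂
    linarith [hsep m n hmn, hb m]

/-- If `τ⁺ = τᵖ`, then Dunford–Pettis operators are weakly compact. If an element `f` of the double
dual is mapped outside `Y` by the second adjoint, there are `gₙ` in the unit ball of `Y*` and
`xₙ` in that of `X` with `gₙ (T xᵢ) = 0` for `i < n` and `gₙ (T xᵢ)` close to some `ε > 0` for
`n ≤ i`; this is incompatible with weak convergence of a subsequence of `gₙ ∘ T`. -/
theorem IsDunfordPettisOperator.isWeaklyCompactOperator [CompleteSpace Y] {T : X →L[𝕜] Y}
    (hT : IsDunfordPettisOperator T)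
    (h : plusTopology 𝕜 (mackeyTopology 𝕜 X) = precompactTopology 𝕜 (mackeyTopology 𝕜 X)) :
    IsWeaklyCompactOperator T := by
  classical
  refine isWeaklyCompactOperator_of_forall_norm_le_one fun f hf => ?_
  by_contra hcon
  let F : StrongDual 𝕜 (StrongDual 𝕜 Y) := f.comp ((ContinuousLinearMap.compL 𝕜 X Y 𝕜).flip T)
  obtain ⟨ε, hε, hF⟩ := exists_forall_finset_exists_apply_eq F hcon
  obtain ⟨u, hu, huu⟩ := exists_seq_of_forall_finset_exists
    (fun q : StrongDual 𝕜 Y × X => ‖q.1‖ ≤ 1 ∧ f (q.1.comp T) = (ε : 𝕜) ∧ ‖q.2‖ ≤ 1 ∧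
      ‖q.1 (T q.2) - ε‖ < ε / 2)
    (fun q q' => q'.1 (T q.2) = 0 ∧ ‖q.1 (T q'.2) - ε‖ < ε / 2) fun s hs => by
      obtain ⟨g, hg, hgs, hgε⟩ := hF (s.image fun q => T q.2)
      obtain ⟨x, hx, hxs⟩ := exists_mem_ball_forall_norm_sub_lt f hf
        (insert (g.comp T) (s.image fun q => q.1.comp T)) (half_pos hε)
      have hgε' : f (g.comp T) = (ε : 𝕜) := hgε
      refine ⟨(g, x), ⟨hg, hgε', hx, ?_⟩, fun q hq => ⟨hgs _ (Finset.mem_image_of_mem _ hq), ?_⟩⟩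
      · have := hxs _ (Finset.mem_insert_self _ _)
        rwa [hgε'] at this
      · have := hxs (q.1.comp T) (Finset.mem_insert_of_mem (Finset.mem_image_of_mem _ hq))
        rwa [(hs q hq).2.1] at this
  have hle : ∀ n i, n ≤ i → ‖(u n).1 (T (u i).2) - ε‖ < ε / 2 := fun n i hni => by
    rcases hni.eq_or_lt with rfl | hlt
    · exact (hu n).2.2.2
    · exact (huu n i hlt).2
  obtain ⟨θ, a, hθ, ha⟩ := hT.exists_subseq_tendstoWeakly h (g := fun n => (u n).1)
    fun n => (hu n).1
  have hax : ∀ i, a (u i).2 = 0 := fun i => by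
    refine tendsto_nhds_unique (ha (NormedSpace.inclusionInDoubleDual 𝕜 X (u i).2)) ?_
    refine tendsto_const_nhds.congr' ?_
    filter_upwards [hθ.tendsto_atTop.eventually_gt_atTop i] with n hn
    exact (huu i _ hn).1.symm
  obtain ⟨f', -, hf'⟩ := exists_weakStar_limit (𝕜 := 𝕜) (hyperfilter ℕ)
    (fun i => NormedSpace.inclusionInDoubleDual 𝕜 X (u i).2) (C := 1)
    (Eventually.of_forall fun i => (NormedSpace.double_dual_bound 𝕜 X _).trans (hu i).2.2.1)
  have hf'a : f' a = 0 := by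
    refine tendsto_nhds_unique (hf' a) (tendsto_const_nhds.congr fun i => ?_)
    exact (hax i).symm
  have hf'u : ∀ n, ‖f' ((u n).1.comp T) - ε‖ ≤ ε / 2 := fun n => by
    refine le_of_tendsto ((hf' _).sub_const _).norm ?_
    filter_upwards [Nat.hyperfilter_le_atTop (eventually_ge_atTop n)] with i hi
    exact (hle n i hi).le
  have := le_of_tendsto' ((ha f').sub_const (ε : 𝕜)).norm fun n => hf'u (θ n)
  rw [hf'a, zero_sub, norm_neg, RCLike.norm_ofReal, abs_of_pos hε] at this
  linarith

end EqualityOfTopologies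

theorem theorem3p16 {𝕜 : Type v} [RCLike 𝕜] {X : Type u} [NormedAddCommGroup X]
    [NormedSpace 𝕜 X] [CompleteSpace X] :
    plusTopology 𝕜 (mackeyTopology 𝕜 X) = precompactTopology 𝕜 (mackeyTopology 𝕜 X) ↔
      HasReciprocalDunfordPettisProperty 𝕜 X := by
  exact ⟨fun h Y _ _ _ _ hT => hT.isWeaklyCompactOperator h, fun h => h.plusTopology_eq⟩
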